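/- Let $K$ be a field, let $n_1,n_2,n_3,n_4$ be pairwise distinct positive integers with $\gcd(n_1,\ldots,n_4)=1$ and $n_1=\min\{n_1,\ldots,n_4\}$, and let $C$ be the monomial curve $x_i=t^{n_i}$ $(1\le i\le 4)$ in $\mathbb{A}^4(K)$. Let $I(C)$ be the kernel of the $K$-algebra homomorphism $K[x_1,\ldots,x_4]\to K[t]$, $x_i\mapsto t^{n_i}$, let $R=K[[t^{n_1},\ldots,t^{n_4}]]$ with maximal ideal $\mathfrak{m}=\langle t^{n_1},\ldots,t^{n_4}\rangle$, and let $\mathrm{gr}_{\mathfrak m}(R)=\bigoplus_{i\ge 0}\mathfrak{m}^i/\mathfrak{m}^{i+1}$. Suppose that $C$ is Gorenstein (that is, $R$ is a Gorenstein local ring) and is not a complete intersection (that is, $I(C)$ cannot be generated by $3$ elements), and that the variables are numbered so that $I(C)$ is minimally generated by the five binomials $$x_3^{a_{13}}x_4^{a_{14}}-x_1^{a_1},\quad x_2^{a_2}-x_1^{a_{21}}x_3^{a_{23}},\quad x_3^{a_3}-x_2^{a_{32}}x_4^{a_{34}},\quad x_4^{a_4}-x_1^{a_{41}}x_2^{a_{42}},\quad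 x_2^{a_{42}}x_3^{a_{13}}-x_1^{a_{21}}x_4^{a_{34}},$$ where all $a_{ij}$ are positive integers and $a_1=a_{21}+a_{41}$, $a_2=a_{32}+a_{42}$, $a_3=a_{13}+a_{23}$, $a_4=a_{14}+a_{34}$. Let $d$ be the least $i\in\mathbb{N}$ such that $a_2-i\,a_{32}\le 0$ or $a_4-i\,a_{34}\le 0$. Suppose that $a_3>a_{32}+a_{34}$. Then $\mathrm{gr}_{\mathfrak m}(R)$ is Cohen–Macaulay if and only if the following conditions hold: 1. $a_2\le a_{21}+a_{23}$; 2. $a_4\le a_{41}+a_{42}$; 3. $a_{42}+a_{13}\le a_{21}+a_{34}$; 4. $(d-1)(a_3-a_{32}-a_{34})+a_2-a_{21}-a_{23}\le 0$; 5. $(d-1)(a_3-a_{32}-a_{34})+a_4+a_{32}-a_1-a_{23}\le 0$; 6. if $a_4-d\,a_{34}>0$, then $d(a_3-a_{32}-a_{34})+a_2-a_{21}-a_{23}\le 0$; 7. if $a_4-d\,a_{34}\le 0$, then $d(a_3-a_{32}-a_{34})+a_4+a_{32}-a_1-a_{23}\le 0$. -/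

import Mathlib

open scoped PowerSeries

namespace MonomialCurve

section Curve

variable (K : Type*) [Field K] {r : ℕ} (n : Fin r → ℕ)

/-- The toric ideal `I(C)` of the monomial curve `x_i = t ^ n_i`: the kernel of the `K`-algebra
homomorphism `K[x_1, …, x_r] → K[t]`, `x_i ↦ t ^ n_i`. -/
noncomputable def toricIdeal : Ideal (MvPolynomial (Fin r) K) :=
  RingHom.ker (MvPolynomial.aeval (fun i => (Polynomial.X : Polynomial K) ^ n i) :
    MvPolynomial (Fin r) K →ₐ[K] Polynomial K)

/-- The numerical semigroup `ℕ n_1 + ⋯ + ℕ n_r`. -/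
def semigroup : AddSubmonoid ℕ := AddSubmonoid.closure (Set.range n)

/-- The ring `R = K[[t ^ n_1, …, t ^ n_r]]`, as the subring of `K[[t]]` of all power series whose
exponents lie in the semigroup generated by `n_1, …, n_r`. -/
noncomputable def semigroupRing : Subalgebra K K⟦X⟧ where
  carrier := {f | ∀ k, PowerSeries.coeff k f ≠ 0 → k ∈ semigroup n}
  mul_mem' := by
    intro f g hf hg k hk
    rw [PowerSeries.coeff_mul] at hk
    obtain ⟨p, hp, hne⟩ := Finset.exists_ne_zero_of_sum_ne_zero hk
    rw [← Finset.HasAntidiagonal.mem_antidiagonal.mp hp]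
    exact add_mem (hf _ (left_ne_zero_of_mul hne)) (hg _ (right_ne_zero_of_mul hne))
  add_mem' := by
    intro f g hf hg k hk
    by_cases h : PowerSeries.coeff k f = 0
    · refine hg k fun h' => hk ?_
      rw [map_add, h, h', add_zero]
    · exact hf k h
  algebraMap_mem' := by
    intro c k hk
    have hk0 : k = 0 := by
      by_contra h0
      refine hk ?_
      rw [PowerSeries.algebraMap_apply, PowerSeries.coeff_C, if_neg h0]
    rw [hk0]
    exact zero_mem _

/-- The element `t ^ n_i` of `R`. -/
noncomputable def generator (i : Fin r) : semigroupRing K n :=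
  ⟨(PowerSeries.X : K⟦X⟧) ^ n i, by
    intro k hk
    rw [PowerSeries.coeff_X_pow] at hk
    have hk' : k = n i := by
      by_contra h
      exact hk (if_neg h)
    rw [hk']
    exact AddSubmonoid.subset_closure ⟨i, rfl⟩⟩

/-- The ideal `𝔪 = ⟨t ^ n_1, …, t ^ n_r⟩` of `R`. -/
noncomputable def maxIdeal : Ideal (semigroupRing K n) :=
  Ideal.span (Set.range (generator K n))

/-- The monomial curve is a complete intersection if its ideal in `K[x_1, …, x_r]`, which has
height `r - 1`, can be generated by `r - 1` elements. -/
def IsCompleteIntersection : Prop :=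
  ∃ g : Fin (r - 1) → MvPolynomial (Fin r) K, Ideal.span (Set.range g) = toricIdeal K n

end Curve

/-- The associated graded ring `gr_I(A) = ⨁ I ^ i / I ^ (i + 1)`, as the quotient
`A[It] / I A[It]` of the Rees algebra `A[It] = ⨁ I ^ i t ^ i`. -/
abbrev AssociatedGraded {A : Type*} [CommRing A] (I : Ideal A) : Type _ :=
  reesAlgebra I ⧸ I.map (algebraMap A (reesAlgebra I))

/-- A Noetherian local ring is Gorenstein if it has finite injective dimension as a module over
itself. -/
structure IsGorensteinLocalRing (A : Type*) [CommRing A] : Prop where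
  isLocalRing : IsLocalRing A
  isNoetherianRing : IsNoetherianRing A
  injectiveDimension_lt_top : CategoryTheory.injectiveDimension (ModuleCat.of A A) < ⊤

/-- A Noetherian local ring is Cohen–Macaulay if its depth equals its Krull dimension, that is,
if there is a regular sequence in the maximal ideal whose length is the Krull dimension (no regular
sequence is longer). -/
def IsCohenMacaulayLocalRing (A : Type*) [CommRing A] [IsLocalRing A] : Prop :=
  IsNoetherianRing A ∧ ∃ rs : List A, (∀ x ∈ rs, x ∈ IsLocalRing.maximalIdeal A) ∧
    RingTheory.Sequence.IsRegular A rs ∧ (rs.length : WithBot ℕ∞) = ringKrullDim A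

/-- A Noetherian ring is Cohen–Macaulay if its localizations at all maximal ideals are. -/
def IsCohenMacaulayRing (A : Type*) [CommRing A] : Prop :=
  IsNoetherianRing A ∧ ∀ (P : Ideal A) [P.IsMaximal],
    IsCohenMacaulayLocalRing (Localization.AtPrime P)

/-- The monomial curve is Gorenstein if its local ring `R = K[[t ^ n_1, …, t ^ n_r]]` is. -/
def IsGorenstein (K : Type*) [Field K] {r : ℕ} (n : Fin r → ℕ) : Prop :=
  IsGorensteinLocalRing (semigroupRing K n)

/-- The positive exponents occurring in the five binomials below, with the four relations among
them. -/
structure Exponents where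
  (a1 a2 a3 a4 a13 a14 a21 a23 a32 a34 a41 a42 : ℕ)
  a13_pos : 0 < a13
  a14_pos : 0 < a14
  a21_pos : 0 < a21
  a23_pos : 0 < a23
  a32_pos : 0 < a32
  a34_pos : 0 < a34
  a41_pos : 0 < a41
  a42_pos : 0 < a42
  a1_eq : a1 = a21 + a41
  a2_eq : a2 = a32 + a42
  a3_eq : a3 = a13 + a23
  a4_eq : a4 = a14 + a34

namespace Exponents

/-- The five binomials `f_1, …, f_5`; the variables `x_1, x_2, x_3, x_4` are
`X 0, X 1, X 2, X 3`. -/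
noncomputable def binomials (K : Type*) [Field K] (e : Exponents) :
    Fin 5 → MvPolynomial (Fin 4) K :=
  let x1 : MvPolynomial (Fin 4) K := MvPolynomial.X 0
  let x2 : MvPolynomial (Fin 4) K := MvPolynomial.X 1
  let x3 : MvPolynomial (Fin 4) K := MvPolynomial.X 2
  let x4 : MvPolynomial (Fin 4) K := MvPolynomial.X 3
  ![x3 ^ e.a13 * x4 ^ e.a14 - x1 ^ e.a1,
    x2 ^ e.a2 - x1 ^ e.a21 * x3 ^ e.a23,
    x3 ^ e.a3 - x2 ^ e.a32 * x4 ^ e.a34,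
    x4 ^ e.a4 - x1 ^ e.a41 * x2 ^ e.a42,
    x2 ^ e.a42 * x3 ^ e.a13 - x1 ^ e.a21 * x4 ^ e.a34]

/-- The least `i` with `a_2 - i a_32 ≤ 0` or `a_4 - i a_34 ≤ 0`. -/
noncomputable def d (e : Exponents) : ℕ :=
  sInf ({i : ℕ | (e.a2 : ℤ) - i * e.a32 ≤ 0} ∪ {i : ℕ | (e.a4 : ℤ) - i * e.a34 ≤ 0})

end Exponents

/-- `e` is the system of exponents of the curve: the five binomials form a minimal generating set
of `I(C)`. -/
def IsMinimallyGeneratedBy (K : Type*) [Field K] (n : Fin 4 → ℕ) (e : Exponents) : Prop :=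
  Ideal.span (Set.range (e.binomials K)) = toricIdeal K n ∧
    ∀ i, Ideal.span (e.binomials K '' {j | j ≠ i}) ≠ toricIdeal K n

end MonomialCurve

/-! For `j ≠ 0` the equality `(t^(n j))^(n 0) = (t^(n 0))^(n j)` and `n 0 < n j` make the class of
`t^(n j)` in degree one of the tangent cone nilpotent. Hence, modulo nilpotents, the tangent cone is
a quotient of the line `K[X]`, with `X ↦ t^(n 0)`, and it is Cohen–Macaulay iff `X` is a
nonzerodivisor. As `𝔪^i` consists of the series whose exponents have a factorization of length at
least `i`, this says that adding `n 0` raises the maximal factorization length by exactly one: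
`OrderAdditive` (`isCohenMacaulayRing_associatedGraded_iff`).

The rest is a comparison of lengths of monomials of equal weight (`orderAdditive_iff_criterion`).
`OrderAdditive` holds as soon as every monomial having the weight of a multiple of `x_1` can be
replaced by a multiple of `x_1` that is at least as long. Since `a_3 > a_32 + a_34`, the only costly
move is exchanging `x_3^a_3` for `x_2^a_32 x_4^a_34`; after at most `d` exchanges another binomial
brings in `x_1`, and the criterion says that the total loss is not positive. Conversely, explicit
weight classes supply a test monomial for each inequality.

In place of Gröbner bases, a set of monomials closed under the five binomials is shown to be a union
of weight classes (`mem_iff_of_closedUnder`). -/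

namespace MonomialCurve

/-! ### Monomials modulo the toric ideal. -/

section Toric

open MvPolynomial

variable {K : Type*} [Field K]

lemma monomial_eq_prod_X (p q r s : ℕ) :
    (monomial (Finsupp.equivFunOnFinite.symm ![p, q, r, s]) (1 : K)) =
      X 0 ^ p * X 1 ^ q * X 2 ^ r * X 3 ^ s := by
  rw [MvPolynomial.monomial_eq, Finsupp.prod_fintype _ _ (by simp)]
  simp [Fin.prod_univ_four]

lemma aeval_X_pow_prod (n : Fin 4 → ℕ) (p q r s : ℕ) :
    (aeval (fun i => (Polynomial.X : Polynomial K) ^ n i))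
      (X 0 ^ p * X 1 ^ q * X 2 ^ r * X 3 ^ s : MvPolynomial (Fin 4) K) =
      Polynomial.X ^ (p * n 0 + q * n 1 + r * n 2 + s * n 3) := by
  simp only [map_mul, map_pow, aeval_X, ← pow_mul, ← pow_add]
  congr 1; ring

lemma sub_mem_toricIdeal_iff (n : Fin 4 → ℕ) (p q r s p' q' r' s' : ℕ) :
    (X 0 ^ p * X 1 ^ q * X 2 ^ r * X 3 ^ s - X 0 ^ p' * X 1 ^ q' * X 2 ^ r' * X 3 ^ s' :
      MvPolynomial (Fin 4) K) ∈ toricIdeal K n ↔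
      p * n 0 + q * n 1 + r * n 2 + s * n 3 = p' * n 0 + q' * n 1 + r' * n 2 + s' * n 3 := by
  rw [toricIdeal, RingHom.mem_ker, map_sub, aeval_X_pow_prod, aeval_X_pow_prod, sub_eq_zero]
  constructor
  · intro h
    simpa using congrArg Polynomial.natDegree h
  · intro h
    rw [h]

/-- The indicator function of a set of monomials, extended linearly. -/
noncomputable def indicator (K : Type*) [Field K] (T : ℕ → ℕ → ℕ → ℕ → Prop) :
    MvPolynomial (Fin 4) K →ₗ[K] K :=
  open Classical in
  (basisMonomials (Fin 4) K).constr K fun v => if T (v 0) (v 1) (v 2) (v 3) then 1 else 0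

open Classical in
lemma indicator_monomial (T : ℕ → ℕ → ℕ → ℕ → Prop) (v : Fin 4 →₀ ℕ) :
    indicator K T (monomial v 1) = if T (v 0) (v 1) (v 2) (v 3) then 1 else 0 := by
  have := (basisMonomials (Fin 4) K).constr_basis K
    (fun v => if T (v 0) (v 1) (v 2) (v 3) then (1 : K) else 0) v
  simpa [indicator] using this

open Classical in
lemma indicator_X_pow (T : ℕ → ℕ → ℕ → ℕ → Prop) (p q r s : ℕ) :
    indicator K T (X 0 ^ p * X 1 ^ q * X 2 ^ r * X 3 ^ s) = if T p q r s then 1 else 0 := by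
  rw [← monomial_eq_prod_X, indicator_monomial]
  simp

/-- A set of monomials is closed under the binomial `x^l - x^r` if replacing the factor `x^l` of a
monomial by `x^r`, or conversely, preserves the set. -/
def ClosedUnder (T : ℕ → ℕ → ℕ → ℕ → Prop) (l r : ℕ × ℕ × ℕ × ℕ) : Prop :=
  ∀ p q s t, T (p + l.1) (q + l.2.1) (s + l.2.2.1) (t + l.2.2.2) ↔
    T (p + r.1) (q + r.2.1) (s + r.2.2.1) (t + r.2.2.2)

/-- By linearity `a` may be a monomial, and then closedness gives both terms the same value. -/
lemma indicator_mul_eq_zero (T : ℕ → ℕ → ℕ → ℕ → Prop) {l r : ℕ × ℕ × ℕ × ℕ}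
    (h : ClosedUnder T l r) (a : MvPolynomial (Fin 4) K) :
    indicator K T (a * (X 0 ^ l.1 * X 1 ^ l.2.1 * X 2 ^ l.2.2.1 * X 3 ^ l.2.2.2 -
      X 0 ^ r.1 * X 1 ^ r.2.1 * X 2 ^ r.2.2.1 * X 3 ^ r.2.2.2)) = 0 := by
  classical
  induction a using MvPolynomial.induction_on' with
  | monomial v c =>
    have hv' : Finsupp.equivFunOnFinite.symm ![v 0, v 1, v 2, v 3] = v := by
      ext i
      fin_cases i <;> rfl
    have hv : monomial v c = c • (X 0 ^ v 0 * X 1 ^ v 1 * X 2 ^ v 2 * X 3 ^ v 3 :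
        MvPolynomial (Fin 4) K) := by
      rw [← monomial_eq_prod_X, smul_monomial, smul_eq_mul, mul_one, hv']
    have e1 : ∀ m : ℕ × ℕ × ℕ × ℕ, (X 0 ^ v 0 * X 1 ^ v 1 * X 2 ^ v 2 * X 3 ^ v 3 :
        MvPolynomial (Fin 4) K) * (X 0 ^ m.1 * X 1 ^ m.2.1 * X 2 ^ m.2.2.1 * X 3 ^ m.2.2.2) =
        X 0 ^ (v 0 + m.1) * X 1 ^ (v 1 + m.2.1) * X 2 ^ (v 2 + m.2.2.1) *
          X 3 ^ (v 3 + m.2.2.2) := by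
      intro m; ring
    rw [hv, smul_mul_assoc, map_smul, mul_sub, e1, e1, map_sub, indicator_X_pow,
      indicator_X_pow, smul_eq_mul]
    simp only [h (v 0) (v 1) (v 2) (v 3), sub_self, mul_zero]
  | add a b ha hb => rw [add_mul, map_add, ha, hb, add_zero]

namespace Exponents

variable (e : Exponents)

/-- The exponents of the monomials with positive coefficient in `e.binomials`. -/
def lhs : Fin 5 → ℕ × ℕ × ℕ × ℕ :=
  ![(0, 0, e.a13, e.a14), (0, e.a2, 0, 0), (0, 0, e.a3, 0), (0, 0, 0, e.a4), (0, e.a42, e.a13, 0)]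

/-- The exponents of the monomials with negative coefficient in `e.binomials`. -/
def rhs : Fin 5 → ℕ × ℕ × ℕ × ℕ :=
  ![(e.a1, 0, 0, 0), (e.a21, 0, e.a23, 0), (0, e.a32, 0, e.a34), (e.a41, e.a42, 0, 0),
    (e.a21, 0, 0, e.a34)]

lemma binomials_eq (i : Fin 5) : e.binomials K i =
    X 0 ^ (e.lhs i).1 * X 1 ^ (e.lhs i).2.1 * X 2 ^ (e.lhs i).2.2.1 * X 3 ^ (e.lhs i).2.2.2 -
      X 0 ^ (e.rhs i).1 * X 1 ^ (e.rhs i).2.1 * X 2 ^ (e.rhs i).2.2.1 *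
        X 3 ^ (e.rhs i).2.2.2 := by
  fin_cases i <;> simp [binomials, lhs, rhs]

end Exponents

variable {e : Exponents} {n : Fin 4 → ℕ}

/-- A set of monomials closed under the five binomials generating the toric ideal is a union of
weight classes. -/
lemma mem_iff_of_closedUnder (he : Ideal.span (Set.range (e.binomials K)) = toricIdeal K n)
    (T : ℕ → ℕ → ℕ → ℕ → Prop) (hT : ∀ i, ClosedUnder T (e.lhs i) (e.rhs i))
    {p q r s p' q' r' s' : ℕ}
    (h : p * n 0 + q * n 1 + r * n 2 + s * n 3 = p' * n 0 + q' * n 1 + r' * n 2 + s' * n 3) :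
    T p q r s ↔ T p' q' r' s' := by
  classical
  have hmem := (sub_mem_toricIdeal_iff (K := K) n p q r s p' q' r' s').2 h
  rw [← he] at hmem
  obtain ⟨c, hc⟩ := Ideal.mem_span_range_iff_exists_fun.1 hmem
  -- The functional kills every multiple of a generator, so it agrees on the two monomials; its
  -- values there are 0 or 1, which differ in `K`.
  have h0 := congrArg (indicator K T) hc
  rw [map_sum, Finset.sum_eq_zero, map_sub, indicator_X_pow, indicator_X_pow] at h0
  · by_cases h1 : T p q r s <;> by_cases h2 : T p' q' r' s' <;> simp [h1, h2] at h0 ⊢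
  · intro i _
    rw [e.binomials_eq]
    exact indicator_mul_eq_zero T (hT i) _

lemma weight_lhs_eq (he : Ideal.span (Set.range (e.binomials K)) = toricIdeal K n) (i : Fin 5) :
    (e.lhs i).1 * n 0 + (e.lhs i).2.1 * n 1 + (e.lhs i).2.2.1 * n 2 + (e.lhs i).2.2.2 * n 3 =
    (e.rhs i).1 * n 0 + (e.rhs i).2.1 * n 1 + (e.rhs i).2.2.1 * n 2 + (e.rhs i).2.2.2 * n 3 := by
  rw [← sub_mem_toricIdeal_iff (K := K), ← e.binomials_eq, ← he]
  exact Ideal.subset_span ⟨i, rfl⟩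

end Toric

end MonomialCurve

/-! ### The criterion suffices: trading a monomial for a multiple of `x_1`. -/

namespace MonomialCurve

/-- `s` is a sum of at least `i` of the `n j`, counted with multiplicity. -/
def HasFactorization {r : ℕ} (n : Fin r → ℕ) (i s : ℕ) : Prop :=
  ∃ v : Fin r → ℕ, ∑ j, v j * n j = s ∧ i ≤ ∑ j, v j

lemma hasFactorization_four {n : Fin 4 → ℕ} {i s : ℕ} : HasFactorization n i s ↔
    ∃ p q r t : ℕ, p * n 0 + q * n 1 + r * n 2 + t * n 3 = s ∧ i ≤ p + q + r + t := by
  constructor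
  · rintro ⟨v, h1, h2⟩
    rw [Fin.sum_univ_four] at h1 h2
    exact ⟨_, _, _, _, h1, h2⟩
  · rintro ⟨p, q, r, t, h1, h2⟩
    refine ⟨![p, q, r, t], ?_, ?_⟩
    · simpa [Fin.sum_univ_four] using h1
    · simpa [Fin.sum_univ_four] using h2

/-- Adding `n_1` to an element of the semigroup raises its order by one only. -/
def OrderAdditive (n : Fin 4 → ℕ) : Prop :=
  ∀ s, HasFactorization n 0 s → ∀ i, HasFactorization n (i + 1) (s + n 0) → HasFactorization n i s

namespace Exponents

variable (e : Exponents)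

/-- The relations between the weights which hold because the first four binomials lie in the toric
ideal, over the integers. -/
structure Relations (n : Fin 4 → ℕ) : Prop where
  w1 : (e.a13 : ℤ) * n 2 + e.a14 * n 3 = e.a1 * n 0
  w2 : (e.a2 : ℤ) * n 1 = e.a21 * n 0 + e.a23 * n 2
  w3 : (e.a3 : ℤ) * n 2 = e.a32 * n 1 + e.a34 * n 3
  w4 : (e.a4 : ℤ) * n 3 = e.a41 * n 0 + e.a42 * n 1

lemma relations {K : Type*} [Field K] {n : Fin 4 → ℕ} {e : Exponents}
    (he : Ideal.span (Set.range (e.binomials K)) = toricIdeal K n) : e.Relations n where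
  w1 := by have := weight_lhs_eq he 0; simp [lhs, rhs] at this; exact_mod_cast this
  w2 := by have := weight_lhs_eq he 1; simp [lhs, rhs] at this; exact_mod_cast this
  w3 := by have := weight_lhs_eq he 2; simp [lhs, rhs] at this; exact_mod_cast this
  w4 := by have := weight_lhs_eq he 3; simp [lhs, rhs] at this; exact_mod_cast this

lemma closedUnder_iff (T : ℕ → ℕ → ℕ → ℕ → Prop) :
    (∀ i, ClosedUnder T (e.lhs i) (e.rhs i)) ↔ ∀ p q r s,
      (T p q (r + e.a13) (s + e.a14) ↔ T (p + e.a1) q r s) ∧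
      (T p (q + e.a2) r s ↔ T (p + e.a21) q (r + e.a23) s) ∧
      (T p q (r + e.a3) s ↔ T p (q + e.a32) r (s + e.a34)) ∧
      (T p q r (s + e.a4) ↔ T (p + e.a41) (q + e.a42) r s) ∧
      (T p (q + e.a42) (r + e.a13) s ↔ T (p + e.a21) q r (s + e.a34)) := by
  simp only [Fin.forall_fin_succ, ClosedUnder, lhs, rhs]
  simp
  grind

lemma d_spec : ((e.a2 : ℤ) - e.d * e.a32 ≤ 0 ∨ (e.a4 : ℤ) - e.d * e.a34 ≤ 0) ∧
    0 < (e.a2 : ℤ) - (e.d - 1) * e.a32 ∧ 0 < (e.a4 : ℤ) - (e.d - 1) * e.a34 ∧ (2 : ℤ) ≤ e.d := by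
  have h32 := e.a32_pos
  have h34 := e.a34_pos
  have hne : ({i : ℕ | (e.a2 : ℤ) - i * e.a32 ≤ 0} ∪
      {i : ℕ | (e.a4 : ℤ) - i * e.a34 ≤ 0}).Nonempty := by
    refine ⟨e.a2, Or.inl ?_⟩
    simp only [Set.mem_ofPred_eq]
    have : (1 : ℤ) ≤ e.a32 := by exact_mod_cast h32
    nlinarith [Int.natCast_nonneg e.a2]
  have h1 := Nat.sInf_mem hne
  have h2 : ∀ i : ℕ, i < e.d → 0 < (e.a2 : ℤ) - i * e.a32 ∧ 0 < (e.a4 : ℤ) - i * e.a34 := by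
    intro i hi
    have := Nat.notMem_of_lt_sInf hi
    simp only [Set.mem_union, Set.mem_ofPred_eq, not_or, not_le] at this
    exact this
  have h1' : (e.a2 : ℤ) - e.d * e.a32 ≤ 0 ∨ (e.a4 : ℤ) - e.d * e.a34 ≤ 0 := h1
  -- At `i = 1` the two differences are `a_42` and `a_14`, both positive.
  have hd : 2 ≤ e.d := by
    by_contra h
    have h4 := e.a4_eq; have h5 := e.a2_eq; have h6 := e.a14_pos; have h7 := e.a42_pos
    have : e.d = 0 ∨ e.d = 1 := by omega
    rcases this with h | h <;> rw [h] at h1' <;> push_cast at h1' <;> omega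
  obtain ⟨k, hk⟩ : ∃ k, e.d = k + 1 := ⟨e.d - 1, by omega⟩
  have := h2 k (by omega)
  refine ⟨h1', ?_, ?_, by exact_mod_cast hd⟩
  · rw [hk]; push_cast; simpa using this.1
  · rw [hk]; push_cast; simpa using this.2

/-- The seven conditions of the criterion. -/
def Criterion : Prop :=
  e.a2 ≤ e.a21 + e.a23 ∧
  e.a4 ≤ e.a41 + e.a42 ∧
  e.a42 + e.a13 ≤ e.a21 + e.a34 ∧
  ((e.d : ℤ) - 1) * ((e.a3 : ℤ) - e.a32 - e.a34) + e.a2 - e.a21 - e.a23 ≤ 0 ∧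
  ((e.d : ℤ) - 1) * ((e.a3 : ℤ) - e.a32 - e.a34) + e.a4 + e.a32 - e.a1 - e.a23 ≤ 0 ∧
  ((e.a4 : ℤ) - e.d * e.a34 > 0 →
    (e.d : ℤ) * ((e.a3 : ℤ) - e.a32 - e.a34) + e.a2 - e.a21 - e.a23 ≤ 0) ∧
  ((e.a4 : ℤ) - e.d * e.a34 ≤ 0 →
    (e.d : ℤ) * ((e.a3 : ℤ) - e.a32 - e.a34) + e.a4 + e.a32 - e.a1 - e.a23 ≤ 0)

/-- A monomial is zero modulo `I(C) + (x_1)`: it is divisible by `x_1`, or some monomial obtained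
from it by exchanging `x_3 ^ a_3` and `x_2 ^ a_32 x_4 ^ a_34` is divisible by a monomial which is
equal modulo `I(C)` to a multiple of `x_1`. -/
def ZeroModFirst (p q r s : ℕ) : Prop :=
  0 < p ∨ ∃ k q' r' s' : ℤ, 0 ≤ q' ∧ 0 ≤ r' ∧ 0 ≤ s' ∧
    q' = q + k * e.a32 ∧ r' = r - k * e.a3 ∧ s' = s + k * e.a34 ∧
    (e.a13 ≤ r' ∧ e.a14 ≤ s' ∨ e.a2 ≤ q' ∨ e.a4 ≤ s' ∨ e.a42 ≤ q' ∧ e.a13 ≤ r')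

/-- The third binomial only shifts `k` by one. For the others both sides hold: the left monomial
witnesses it with `k = 0`, the right one contains `x_1`. -/
lemma closedUnder_zeroModFirst (i : Fin 5) : ClosedUnder e.ZeroModFirst (e.lhs i) (e.rhs i) := by
  revert i
  rw [closedUnder_iff]
  intro p q r s
  have h1 := e.a1_eq; have h21 := e.a21_pos; have h41 := e.a41_pos
  refine ⟨?_, ?_, ?_, ?_, ?_⟩
  · refine iff_of_true (Or.inr ⟨0, q, r + e.a13, s + e.a14, ?_⟩) (Or.inl (by omega))
    simp; omega
  · refine iff_of_true (Or.inr ⟨0, q + e.a2, r, s, ?_⟩) (Or.inl (by omega))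
    simp; omega
  · constructor
    · rintro (h | ⟨k, q', r', s', hq, hr, hs, e1, e2, e3, h⟩)
      · exact Or.inl h
      · refine Or.inr ⟨k - 1, q', r', s', hq, hr, hs, ?_, ?_, ?_, h⟩ <;> push_cast at * <;> linarith
    · rintro (h | ⟨k, q', r', s', hq, hr, hs, e1, e2, e3, h⟩)
      · exact Or.inl h
      · refine Or.inr ⟨k + 1, q', r', s', hq, hr, hs, ?_, ?_, ?_, h⟩ <;> push_cast at * <;> linarith
  · refine iff_of_true (Or.inr ⟨0, q, r, s + e.a4, ?_⟩) (Or.inl (by omega))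
    simp; omega
  · refine iff_of_true (Or.inr ⟨0, q + e.a42, r + e.a13, s, ?_⟩) (Or.inl (by omega))
    simp; omega

variable {e} {n : Fin 4 → ℕ}

/-- The witness comes from exchanging `x_3^a_3` several times and then applying a binomial that
produces `x_1`. The loss of length grows linearly in the number of exchanges, with slope `a_3 - a_32
- a_34 > 0`, so it is enough to bound it at the largest number needed. -/
lemma exists_pos_of_zeroModFirst_of_irreducible (hrel : e.Relations n) (h3 : e.a32 + e.a34 < e.a3)
    (hc : e.Criterion) {q r s k q' r' s' : ℤ} (hk : 0 ≤ k) (hq : 0 ≤ q) (hr : 0 ≤ r) (hs : 0 ≤ s)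
    (hr' : 0 ≤ r')
    (e1 : q' = q + k * e.a32) (e2 : r' = r - k * e.a3) (e3 : s' = s + k * e.a34)
    (h : e.a13 ≤ r' ∧ e.a14 ≤ s' ∨ e.a2 ≤ q' ∨ e.a4 ≤ s' ∨ e.a42 ≤ q' ∧ e.a13 ≤ r') :
    ∃ p'' q'' r'' s'' : ℤ, 0 < p'' ∧ 0 ≤ q'' ∧ 0 ≤ r'' ∧ 0 ≤ s'' ∧
      p'' * n 0 + q'' * n 1 + r'' * n 2 + s'' * n 3 = q * n 1 + r * n 2 + s * n 3 ∧
      q + r + s ≤ p'' + q'' + r'' + s'' := by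
  obtain ⟨w1, w2, w3, w4⟩ := hrel
  obtain ⟨c1, c2, c3, c4, c5, c6, c7⟩ := hc
  obtain ⟨hd, hd2, hd4, hd0⟩ := e.d_spec
  obtain ⟨a1, a2, a3, a4, a13, a14, a21, a23, a32, a34, a41, a42, p13, p14, p21, p23, p32, p34, p41,
    p42, q1, q2, q3, q4⟩ := e
  simp only at *
  generalize (Exponents.d _ : ℤ) = d at *
  zify at *
  generalize (a1 : ℤ) = a1, (a2 : ℤ) = a2, (a3 : ℤ) = a3, (a4 : ℤ) = a4, (a13 : ℤ) = a13,
    (a14 : ℤ) = a14, (a21 : ℤ) = a21, (a23 : ℤ) = a23, (a32 : ℤ) = a32, (a34 : ℤ) = a34,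
    (a41 : ℤ) = a41, (a42 : ℤ) = a42, (n 0 : ℤ) = n0, (n 1 : ℤ) = n1, (n 2 : ℤ) = n2,
    (n 3 : ℤ) = n3 at *
  have hD : 0 < a3 - a32 - a34 := by linarith
  have hd32 : 0 ≤ (d - 1) * a32 := mul_nonneg (by linarith) p32.le
  have hd34 : 0 ≤ d * a34 := mul_nonneg (by linarith) p34.le
  by_cases hlast : d * a3 - a23 ≤ r
  -- Modulo `I(C)`, `x_3^(d a_3 - a_23)` equals `x_1^a_21 x_2^(d a_32 - a_2) x_4^(d a_34)` and,
  -- formally, `x_1^a_1 x_2^((d-1) a_32) x_4^(d a_34 - a_4)`. The choice of `d` makes the exponents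
  -- of the selected one nonnegative; conditions 6 and 7 compare lengths.
  · by_cases hA : 0 < a4 - d * a34
    · have := c6 hA
      refine ⟨a21, q + d * a32 - a2, r - (d * a3 - a23), s + d * a34, p21, ?_, ?_, ?_, ?_, ?_⟩
      · rcases hd with h | h <;> linarith
      · linarith
      · linarith
      · linear_combination (-1) * w2 + (-d) * w3
      · linarith
    · have := c7 (by linarith)
      refine ⟨a1, q + (d - 1) * a32, r - (d * a3 - a23), s + d * a34 - a4, by linarith,
        ?_, ?_, ?_, ?_, ?_⟩
      · linarith
      · linarith
      · linarith
      · subst q1 q2 q3 q4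
        linear_combination (-1) * w2 + (-d) * w3 - w4
      · linarith
  · have hkd : k ≤ d - 1 := by
      by_contra hcon
      have : d * a3 ≤ k * a3 := mul_le_mul_of_nonneg_right (by linarith) (by linarith)
      linarith
    have hkd' : k * (a3 - a32 - a34) ≤ (d - 1) * (a3 - a32 - a34) :=
      mul_le_mul_of_nonneg_right hkd hD.le
    -- With `k = d - 1`, `r` would be at least `(d-1) a_3 + a_13 = d a_3 - a_23`, the case already
    -- treated.
    have hkd1 : a13 ≤ r' → k + 1 ≤ d - 1 := by
      intro hr1
      by_contra hcon
      have : d = k + 1 := by linarith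
      subst this
      linarith
    have hkd1' : a13 ≤ r' → (k + 1) * (a3 - a32 - a34) ≤ (d - 1) * (a3 - a32 - a34) := by
      intro hr1
      exact mul_le_mul_of_nonneg_right (hkd1 hr1) hD.le
    have hk32 : 0 ≤ k * a32 := by positivity
    have hk34 : 0 ≤ k * a34 := by positivity
    rcases h with ⟨h, h'⟩ | h | h | ⟨h, h'⟩
    · refine ⟨a1, q + k * a32, r - ((k + 1) * a3 - a23), s - (a4 - (k + 1) * a34), by linarith,
        ?_, ?_, ?_, ?_, ?_⟩
      · linarith
      · linarith
      · linarith
      · subst q1 q2 q3 q4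
        linear_combination (-1) * w1 - k * w3
      · linarith [hkd1' h]
    · refine ⟨a21, q + k * a32 - a2, r - k * a3 + a23, s + k * a34, p21, ?_, ?_, ?_, ?_, ?_⟩
      · linarith
      · linarith
      · linarith
      · linear_combination (-1) * w2 - k * w3
      · linarith
    · rcases eq_or_lt_of_le hk with hk0 | hk0
      · subst hk0
        refine ⟨a41, q + a42, r, s - a4, p41, ?_, ?_, ?_, ?_, ?_⟩
        · linarith
        · linarith
        · linarith
        · linear_combination (-1) * w4
        · linarith
      -- For `k ≥ 1` the first binomial already applies after `k - 1` exchanges: one `x_3^a_3` is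
      -- still left, and the exponent of `x_4` is at least `a_4 - a_34 = a_14`.
      · have : a32 ≤ k * a32 := le_mul_of_one_le_left p32.le hk0
        have : a3 ≤ k * a3 := le_mul_of_one_le_left (by linarith) hk0
        refine ⟨a1, q + (k - 1) * a32, r - (k * a3 - a23), s - (a4 - k * a34), by linarith,
        ?_, ?_, ?_, ?_, ?_⟩
        · linarith
        · linarith
        · linarith
        · subst q1 q2 q3 q4
          linear_combination (-1) * w1 - (k - 1) * w3
        · linarith
    · refine ⟨a21, q - (a2 - (k + 1) * a32), r - ((k + 1) * a3 - a23), s + (k + 1) * a34, p21,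
        ?_, ?_, ?_, ?_, ?_⟩
      · linarith
      · linarith
      · linarith
      · linear_combination (-1) * w2 - (k + 1) * w3
      · linarith [hkd1' h']

/-- Replacing `x_2^a_32 x_4^a_34` by `x_3^a_3` lengthens the monomial and lowers `q`, so induction
on `q` reduces to monomials where this is impossible. -/
lemma exists_pos_of_zeroModFirst (hrel : e.Relations n) (h3 : e.a32 + e.a34 < e.a3)
    (hc : e.Criterion) (p q r s : ℕ) (hz : e.ZeroModFirst p q r s) :
    ∃ p' q' r' s' : ℕ, 0 < p' ∧
      p' * n 0 + q' * n 1 + r' * n 2 + s' * n 3 = p * n 0 + q * n 1 + r * n 2 + s * n 3 ∧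
      p + q + r + s ≤ p' + q' + r' + s' := by
  induction q using Nat.strong_induction_on generalizing r s with
  | _ q ih =>
  rcases Nat.eq_zero_or_pos p with rfl | hp
  swap
  · exact ⟨p, q, r, s, hp, rfl, le_rfl⟩
  by_cases hred : e.a32 ≤ q ∧ e.a34 ≤ s
  · obtain ⟨q, rfl⟩ := Nat.exists_eq_add_of_le' hred.1
    obtain ⟨s, rfl⟩ := Nat.exists_eq_add_of_le' hred.2
    have hz' : e.ZeroModFirst 0 q (r + e.a3) s :=
      (((e.closedUnder_iff _).1 e.closedUnder_zeroModFirst 0 q r s).2.2.1).2 hz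
    obtain ⟨p', q', r', s', h0, hw, hle⟩ := ih q (by have := e.a32_pos; omega) _ _ hz'
    refine ⟨p', q', r', s', h0, ?_, by omega⟩
    rw [hw]
    zify
    linear_combination hrel.w3
  · rcases hz with h | ⟨k, q', r', s', hq, hr, hs, e1, e2, e3, h⟩
    · omega
    -- A negative `k` takes at least `a_32` from `q` and `a_34` from `s`, which irreducibility
    -- forbids.
    have hk : 0 ≤ k := by
      by_contra hk
      have h1 : (e.a32 : ℤ) ≤ q := by nlinarith [e.a32_pos]
      have h2 : (e.a34 : ℤ) ≤ s := by nlinarith [e.a34_pos]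
      omega
    obtain ⟨p'', q'', r'', s'', hp, hq2, hr2, hs2, hw, hle⟩ :=
      exists_pos_of_zeroModFirst_of_irreducible hrel h3 hc hk (Int.natCast_nonneg q)
        (Int.natCast_nonneg r) (Int.natCast_nonneg s) hr e1 e2 e3 h
    lift p'' to ℕ using hp.le
    lift q'' to ℕ using hq2
    lift r'' to ℕ using hr2
    lift s'' to ℕ using hs2
    refine ⟨p'', q'', r'', s'', by omega, ?_, by omega⟩
    zify
    linear_combination hw

lemma orderAdditive_of_criterion {K : Type*} [Field K]
    (he : Ideal.span (Set.range (e.binomials K)) = toricIdeal K n) (h3 : e.a32 + e.a34 < e.a3)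
    (hc : e.Criterion) : OrderAdditive n := by
  intro s hs i hi
  rw [hasFactorization_four] at hs hi ⊢
  obtain ⟨p, q, r, t, hw, -⟩ := hs
  obtain ⟨p', q', r', t', hw', hi⟩ := hi
  have hz : e.ZeroModFirst p' q' r' t' := by
    rw [mem_iff_of_closedUnder he _ e.closedUnder_zeroModFirst
      (p' := p + 1) (q' := q) (r' := r) (s' := t)]
    · exact Or.inl (Nat.succ_pos p)
    · rw [hw', ← hw]; ring
  obtain ⟨p'', q'', r'', t'', h0, hw2, hle⟩ :=
    exists_pos_of_zeroModFirst (relations he) h3 hc _ _ _ _ hz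
  obtain ⟨p'', rfl⟩ := Nat.exists_eq_add_of_le' h0
  refine ⟨p'', q'', r'', t'', ?_, by omega⟩
  rw [hw'] at hw2
  linarith

end Exponents

end MonomialCurve

/-! ### Explicit weight classes. -/

namespace MonomialCurve

namespace Exponents

variable {K : Type*} [Field K] {n : Fin 4 → ℕ} {e : Exponents}

/-- Removing one `n 0` from the weight lowers the order by one only, so some monomial of the class
containing `x_1` is as long as the given one without `x_1`; `hmax` bounds it. -/
lemma degree_le_of_orderAdditive (he : Ideal.span (Set.range (e.binomials K)) = toricIdeal K n)
    (hord : OrderAdditive n) {T : ℕ → ℕ → ℕ → ℕ → Prop}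
    (hT : ∀ i, ClosedUnder T (e.lhs i) (e.rhs i)) {q r s p' q' r' s' : ℤ}
    (hq : 0 ≤ q) (hr : 0 ≤ r) (hs : 0 ≤ s) (hp' : 0 < p') (hq' : 0 ≤ q') (hr' : 0 ≤ r')
    (hs' : 0 ≤ s') (hmem : T p'.toNat q'.toNat r'.toNat s'.toNat)
    (hw : q * n 1 + r * n 2 + s * n 3 = p' * n 0 + q' * n 1 + r' * n 2 + s' * n 3)
    (hmax : ∀ p q r s : ℕ, T p q r s → 0 < p → (p + q + r + s : ℤ) ≤ p' + q' + r' + s') :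
    q + r + s ≤ p' + q' + r' + s' := by
  lift q to ℕ using hq
  lift r to ℕ using hr
  lift s to ℕ using hs
  obtain ⟨p', rfl⟩ : ∃ k : ℕ, p' = k + 1 := ⟨(p' - 1).toNat, by omega⟩
  lift q' to ℕ using hq'
  lift r' to ℕ using hr'
  lift s' to ℕ using hs'
  -- Length zero is set apart because `q + r + s - 1` below is truncated.
  rcases Nat.eq_zero_or_pos (q + r + s) with h0 | h0
  · omega
  have h1 : HasFactorization n (q + r + s - 1) (p' * n 0 + q' * n 1 + r' * n 2 + s' * n 3) := by
    apply hord
    · exact hasFactorization_four.2 ⟨p', q', r', s', rfl, Nat.zero_le _⟩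
    · refine hasFactorization_four.2 ⟨0, q, r, s, ?_, by omega⟩
      zify
      linear_combination hw
  obtain ⟨u, v, w, t, h2, h3⟩ := hasFactorization_four.1 h1
  have h4 : T (u + 1) v w t := by
    rw [mem_iff_of_closedUnder he T hT (p' := p' + 1) (q' := q') (r' := r') (s' := s')]
    · exact hmem
    · linarith
  have := hmax _ _ _ _ h4 (Nat.succ_pos u)
  push_cast at this
  omega

/-- The monomials equal to `x_4 ^ a_4` modulo `I(C)`. -/
def ClassX4 (e : Exponents) (p q r s : ℕ) : Prop :=
  p = 0 ∧ q = 0 ∧ r = 0 ∧ s = e.a4 ∨ p = e.a41 ∧ q = e.a42 ∧ r = 0 ∧ s = 0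

lemma closedUnder_classX4 (i : Fin 5) : ClosedUnder e.ClassX4 (e.lhs i) (e.rhs i) := by
  revert i
  rw [closedUnder_iff]
  obtain ⟨a1, a2, a3, a4, a13, a14, a21, a23, a32, a34, a41, a42, p13, p14, p21, p23, p32, p34, p41,
    p42, q1, q2, q3, q4⟩ := e
  intro p q r s
  simp only [ClassX4]
  omega

/-- The monomials equal to `x_1 ^ a_21 x_4 ^ (j a_34)` modulo `I(C)`. -/
def ClassX1X4 (e : Exponents) (j : ℤ) (p q r s : ℕ) : Prop :=
  p = e.a21 ∧ q = 0 ∧ r = 0 ∧ (s : ℤ) = j * e.a34 ∨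
    ∃ i : ℤ, 1 ≤ i ∧ i ≤ j ∧ p = 0 ∧ (q : ℤ) = e.a2 - i * e.a32 ∧ (r : ℤ) = i * e.a3 - e.a23 ∧
      (s : ℤ) = j * e.a34 - i * e.a34

/-- These disjunctions let `omega` treat the products `i * x` and `j * x` as atoms. -/
lemma mul_bounds {i j x : ℤ} (h1 : 1 ≤ i) (h2 : i ≤ j) (hx : 0 < x) :
    (i = 1 ∧ i * x = x ∨ 2 ≤ i ∧ 2 * x ≤ i * x) ∧
      (i = j ∧ i * x = j * x ∨ i + 1 ≤ j ∧ i * x + x ≤ j * x) := by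
  constructor
  · rcases eq_or_lt_of_le h1 with h | h
    · subst h; simp
    · exact Or.inr ⟨h, mul_le_mul_of_nonneg_right h hx.le⟩
  · rcases eq_or_lt_of_le h2 with h | h
    · subst h; simp
    · exact Or.inr ⟨h, by nlinarith⟩

/-- The class is a chain: the fifth binomial links the monomial with `x_1` to `i = 1`, the third
links `i` to `i + 1`, and the bounds on `j` keep the other three from applying. -/
lemma closedUnder_classX1X4 {j : ℤ} (hj : 1 ≤ j) (h2 : 0 < (e.a2 : ℤ) - j * e.a32)
    (h4 : 0 < (e.a4 : ℤ) - j * e.a34) (i : Fin 5) :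
    ClosedUnder (e.ClassX1X4 j) (e.lhs i) (e.rhs i) := by
  revert i
  rw [closedUnder_iff]
  obtain ⟨a1, a2, a3, a4, a13, a14, a21, a23, a32, a34, a41, a42, p13, p14, p21, p23, p32, p34, p41,
    p42, q1, q2, q3, q4⟩ := e
  simp only at *
  have hb3 : ∀ i : ℤ, 1 ≤ i → i ≤ j → _ := fun i h h' =>
    mul_bounds (x := (a3 : ℤ)) h h' (by omega)
  have hb32 : ∀ i : ℤ, 1 ≤ i → i ≤ j → _ := fun i h h' =>
    mul_bounds (x := (a32 : ℤ)) h h' (by omega)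
  have hb34 : ∀ i : ℤ, 1 ≤ i → i ≤ j → _ := fun i h h' =>
    mul_bounds (x := (a34 : ℤ)) h h' (by omega)
  have hj34 := hb34 1 le_rfl hj
  intro p q r s
  simp only [ClassX1X4]
  push_cast
  refine ⟨iff_of_false ?_ ?_, iff_of_false ?_ ?_, ⟨?_, ?_⟩, iff_of_false ?_ ?_, ⟨?_, ?_⟩⟩ <;>
    rintro (⟨hp, hq, hr, hs⟩ | ⟨i, hi, hij, hp, hq, hr, hs⟩) <;>
    first
    | (exfalso; omega)
    | (have b3 := hb3 i hi hij
       have b32 := hb32 i hi hij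
       have b34 := hb34 i hi hij
       first
       | (exfalso; omega)
       | (refine Or.inl ⟨?_, ?_, ?_, ?_⟩ <;> omega)
       | (exact Or.inr ⟨i + 1, by omega, by omega, by omega, by linarith, by linarith, by linarith⟩)
       | (exact Or.inr ⟨i - 1, by omega, by omega, by omega, by linarith, by linarith, by linarith⟩))
    | (refine Or.inr ⟨1, le_rfl, hj, ?_, ?_, ?_, ?_⟩ <;> omega)

/-- The monomials equal to `x_1 ^ a_1 x_2 ^ ((j - 1) a_32)` modulo `I(C)`. -/
def ClassX1X2 (e : Exponents) (j : ℤ) (p q r s : ℕ) : Prop :=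
  p = e.a1 ∧ (q : ℤ) = j * e.a32 - e.a32 ∧ r = 0 ∧ s = 0 ∨
    ∃ i : ℤ, 1 ≤ i ∧ i ≤ j ∧ p = 0 ∧ (q : ℤ) = j * e.a32 - i * e.a32 ∧
      (r : ℤ) = i * e.a3 - e.a23 ∧ (s : ℤ) = e.a4 - i * e.a34

/-- Again a chain, now entered from the monomial with `x_1` by the first binomial. -/
lemma closedUnder_classX1X2 {j : ℤ} (hj : 1 ≤ j) (h2 : 0 < (e.a2 : ℤ) - j * e.a32)
    (h4 : 0 < (e.a4 : ℤ) - j * e.a34) (i : Fin 5) :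
    ClosedUnder (e.ClassX1X2 j) (e.lhs i) (e.rhs i) := by
  revert i
  rw [closedUnder_iff]
  obtain ⟨a1, a2, a3, a4, a13, a14, a21, a23, a32, a34, a41, a42, p13, p14, p21, p23, p32, p34, p41,
    p42, q1, q2, q3, q4⟩ := e
  simp only at *
  have hb3 : ∀ i : ℤ, 1 ≤ i → i ≤ j → _ := fun i h h' =>
    mul_bounds (x := (a3 : ℤ)) h h' (by omega)
  have hb32 : ∀ i : ℤ, 1 ≤ i → i ≤ j → _ := fun i h h' =>
    mul_bounds (x := (a32 : ℤ)) h h' (by omega)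
  have hb34 : ∀ i : ℤ, 1 ≤ i → i ≤ j → _ := fun i h h' =>
    mul_bounds (x := (a34 : ℤ)) h h' (by omega)
  have hj32 := hb32 1 le_rfl hj
  intro p q r s
  simp only [ClassX1X2]
  push_cast
  refine ⟨⟨?_, ?_⟩, iff_of_false ?_ ?_, ⟨?_, ?_⟩, iff_of_false ?_ ?_, iff_of_false ?_ ?_⟩ <;>
    rintro (⟨hp, hq, hr, hs⟩ | ⟨i, hi, hij, hp, hq, hr, hs⟩) <;>
    first
    | (exfalso; omega)
    | (have b3 := hb3 i hi hij
       have b32 := hb32 i hi hij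
       have b34 := hb34 i hi hij
       first
       | (exfalso; omega)
       | (refine Or.inl ⟨?_, ?_, ?_, ?_⟩ <;> omega)
       | (exact Or.inr ⟨i + 1, by omega, by omega, by omega, by linarith, by linarith, by linarith⟩)
       | (exact Or.inr ⟨i - 1, by omega, by omega, by omega, by linarith, by linarith, by linarith⟩))
    | (refine Or.inr ⟨1, le_rfl, hj, ?_, ?_, ?_, ?_⟩ <;> omega)

/-- The monomials equal to `x_3 ^ (d a_3 - a_23)` modulo `I(C)`. -/
def ClassX3 (e : Exponents) (d : ℤ) (p q r s : ℕ) : Prop :=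
  (∃ k : ℤ, 0 ≤ k ∧ (p : ℤ) = e.a1 - k * e.a41 ∧ (q : ℤ) = d * e.a32 - e.a32 - k * e.a42 ∧ r = 0 ∧
      (s : ℤ) = d * e.a34 + k * e.a4 - e.a4) ∨
    ∃ i : ℤ, 1 ≤ i ∧ i ≤ d ∧ p = 0 ∧ (q : ℤ) = d * e.a32 - i * e.a32 ∧
      (r : ℤ) = i * e.a3 - e.a23 ∧ (s : ℤ) = d * e.a34 - i * e.a34

/-- The third binomial moves along `i` and the fourth along `k`; from `i = 1` the first leads to `k
= 0` and the fifth to `k = 1`, when these monomials exist. -/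
lemma closedUnder_classX3 {d : ℤ} (hd : 1 ≤ d) (h2 : 0 < (e.a2 : ℤ) - (d - 1) * e.a32)
    (h4 : 0 < (e.a4 : ℤ) - (d - 1) * e.a34) (i : Fin 5) :
    ClosedUnder (e.ClassX3 d) (e.lhs i) (e.rhs i) := by
  revert i
  rw [closedUnder_iff]
  obtain ⟨a1, a2, a3, a4, a13, a14, a21, a23, a32, a34, a41, a42, p13, p14, p21, p23, p32, p34, p41,
    p42, q1, q2, q3, q4⟩ := e
  simp only at *
  rw [sub_mul, one_mul] at h2 h4
  have hb3 : ∀ i : ℤ, 1 ≤ i → i ≤ d → _ := fun i h h' =>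
    mul_bounds (x := (a3 : ℤ)) h h' (by omega)
  have hb32 : ∀ i : ℤ, 1 ≤ i → i ≤ d → _ := fun i h h' =>
    mul_bounds (x := (a32 : ℤ)) h h' (by omega)
  have hb34 : ∀ i : ℤ, 1 ≤ i → i ≤ d → _ := fun i h h' =>
    mul_bounds (x := (a34 : ℤ)) h h' (by omega)
  have hd32 := hb32 1 le_rfl hd
  have hd34 := hb34 1 le_rfl hd
  have hk : ∀ k x : ℤ, 0 ≤ k → 0 < x →
      k = 0 ∧ k * x = 0 ∨ k = 1 ∧ k * x = x ∨ 2 ≤ k ∧ 2 * x ≤ k * x := by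
    intro k x hk hx
    rcases eq_or_lt_of_le hk with h | h
    · subst h; simp
    · exact Or.inr ((mul_bounds h le_rfl hx).1)
  intro p q r s
  simp only [ClassX3]
  push_cast
  refine ⟨⟨?_, ?_⟩, iff_of_false ?_ ?_, ⟨?_, ?_⟩, ⟨?_, ?_⟩, ⟨?_, ?_⟩⟩ <;>
    rintro (⟨k, hk0, hp, hq, hr, hs⟩ | ⟨i, hi, hij, hp, hq, hr, hs⟩) <;>
    first
    | (exfalso; omega)
    | (have b41 := hk k a41 hk0 (by omega)
       have b42 := hk k a42 hk0 (by omega)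
       have b4 := hk k a4 hk0 (by omega)
       first
       | (exfalso; omega)
       | (exact Or.inl ⟨k + 1, by omega, by linarith, by linarith, by omega, by linarith⟩)
       | (exact Or.inl ⟨k - 1, by omega, by linarith, by linarith, by omega, by linarith⟩)
       | (refine Or.inr ⟨1, le_rfl, hd, ?_, ?_, ?_, ?_⟩ <;> omega))
    | (have b3 := hb3 i hi hij
       have b32 := hb32 i hi hij
       have b34 := hb34 i hi hij
       first
       | (exfalso; omega)
       | (refine Or.inl ⟨0, le_rfl, ?_, ?_, ?_, ?_⟩ <;> omega)
       | (refine Or.inl ⟨1, zero_le_one, ?_, ?_, ?_, ?_⟩ <;> omega)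
       | (exact Or.inr ⟨i + 1, by omega, by omega, by omega, by linarith, by linarith, by linarith⟩)
       | (exact Or.inr ⟨i - 1, by omega, by omega, by omega, by linarith, by linarith, by linarith⟩))

end Exponents

end MonomialCurve

/-! ### The criterion is necessary. -/

namespace MonomialCurve

namespace Exponents

variable {K : Type*} [Field K] {n : Fin 4 → ℕ} {e : Exponents}

lemma criterion_of_orderAdditive (he : Ideal.span (Set.range (e.binomials K)) = toricIdeal K n)
    (h3 : e.a32 + e.a34 < e.a3) (hord : OrderAdditive n) : e.Criterion := by
  obtain ⟨w1, w2, w3, w4⟩ := relations he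
  obtain ⟨hd, hd2, hd4, hd0⟩ := e.d_spec
  have q1 := e.a1_eq
  have q2 := e.a2_eq
  have q3 := e.a3_eq
  have q4 := e.a4_eq
  have p14 := e.a14_pos
  have p21 := e.a21_pos
  have p32 := e.a32_pos
  have p34 := e.a34_pos
  have p41 := e.a41_pos
  have p42 := e.a42_pos
  zify at q1 q2 q3 q4 h3 p14 p21 p32 p34 p41 p42
  have hT1 := closedUnder_classX1X4 (e := e) (j := e.d - 1) (by linarith) hd2 hd4
  have hT2 := closedUnder_classX1X2 (e := e) (j := e.d - 1) (by linarith) hd2 hd4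
  have hT3 := closedUnder_classX3 (e := e) (d := e.d) (by linarith) hd2 hd4
  unfold Criterion
  generalize (e.d : ℤ) = d at hd hd2 hd4 hd0 hT1 hT2 hT3 ⊢
  have x32 : (d - 1) * e.a32 = d * e.a32 - e.a32 := by ring
  have x34 : (d - 1) * e.a34 = d * e.a34 - e.a34 := by ring
  have m32 : (e.a32 : ℤ) ≤ (d - 1) * e.a32 := le_mul_of_one_le_left p32.le (by linarith)
  have m34 : (e.a34 : ℤ) ≤ (d - 1) * e.a34 := le_mul_of_one_le_left p34.le (by linarith)
  have m3 : (e.a3 : ℤ) ≤ (d - 1) * e.a3 := le_mul_of_one_le_left (by linarith) (by linarith)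
  have mD : (e.a3 : ℤ) - e.a32 - e.a34 ≤ (d - 1) * ((e.a3 : ℤ) - e.a32 - e.a34) :=
    le_mul_of_one_le_left (by linarith) (by linarith)
  have c2 := degree_le_of_orderAdditive he hord (e.closedUnder_classX4) (q := 0) (r := 0)
    (s := e.a4) (p' := e.a41) (q' := e.a42) (r' := 0) (s' := 0) (by omega) (by omega) (by omega)
    (by omega) (by omega) (by omega) (by omega) (by simp [ClassX4]) (by linear_combination w4)
    (by rintro p q r s (h | h) hp <;> omega)
  have c4 := degree_le_of_orderAdditive he hord hT1 (q := e.a2 - (d - 1) * e.a32)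
    (r := (d - 1) * e.a3 - e.a23) (s := 0) (p' := e.a21) (q' := 0) (r' := 0)
    (s' := (d - 1) * e.a34) (by omega) (by omega) (by omega)
    (by omega) (by omega) (by omega) (by omega)
    (by refine Or.inl ⟨?_, ?_, ?_, ?_⟩ <;> omega) (by linear_combination w2 + (d - 1) * w3)
    (by rintro p q r s (h | ⟨i, h⟩) hp <;> omega)
  have c5 := degree_le_of_orderAdditive he hord hT2 (q := 0)
    (r := (d - 1) * e.a3 - e.a23) (s := e.a4 - (d - 1) * e.a34) (p' := e.a1)
    (q' := (d - 1) * e.a32 - e.a32) (r' := 0) (s' := 0) (by omega) (by omega) (by omega)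
    (by omega) (by omega) (by omega) (by omega)
    (by refine Or.inl ⟨?_, ?_, ?_, ?_⟩ <;> omega)
    (by rw [q1]; rw [q2] at w2; linear_combination w4 + (d - 1) * w3 + w2)
    (by rintro p q r s (h | ⟨i, h⟩) hp <;> omega)
  -- Raising `k` in `ClassX3` changes the length by `a_4 - a_41 - a_42`, so the longest member with
  -- `x_1` has the least admissible `k`: 1 if `a_4 > d a_34`, otherwise 0.
  have hR : ∀ k : ℤ, 0 ≤ k → k * (e.a4 - e.a41 - e.a42) ≤ 0 := fun k hk =>
    mul_nonpos_of_nonneg_of_nonpos hk (by linarith)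
  have c6 : 0 < (e.a4 : ℤ) - d * e.a34 → d * e.a3 - e.a23 ≤
      e.a21 + (d * e.a32 - e.a2) + d * e.a34 := by
    intro h4
    have := degree_le_of_orderAdditive he hord hT3 (q := 0) (r := d * e.a3 - e.a23) (s := 0)
      (p' := e.a21) (q' := d * e.a32 - e.a2) (r' := 0) (s' := d * e.a34)
      le_rfl (by linarith) le_rfl p21 (by rcases hd with h | h <;> linarith) le_rfl (by linarith)
      (by refine Or.inl ⟨1, ?_, ?_, ?_, ?_, ?_⟩ <;> omega) (by linear_combination w2 + d * w3) (by
        rintro p q r s (⟨k, hk, h1, h2, h3, h5⟩ | ⟨i, h⟩) hp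
        · rcases eq_or_lt_of_le hk with h | h
          · subst h; omega
          · have := hR (k - 1) (by linarith)
            have h3' : (r : ℤ) = 0 := by exact_mod_cast h3
            linarith
        · omega)
    linarith
  have c7 : (e.a4 : ℤ) - d * e.a34 ≤ 0 → d * e.a3 - e.a23 ≤
      e.a1 + (d * e.a32 - e.a32) + (d * e.a34 - e.a4) := by
    intro h4
    have := degree_le_of_orderAdditive he hord hT3 (q := 0) (r := d * e.a3 - e.a23) (s := 0)
      (p' := e.a1) (q' := d * e.a32 - e.a32) (r' := 0) (s' := d * e.a34 - e.a4)
      le_rfl (by linarith) le_rfl (by linarith) (by linarith) le_rfl (by linarith)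
      (by refine Or.inl ⟨0, ?_, ?_, ?_, ?_, ?_⟩ <;> omega)
      (by rw [q1]; rw [q2] at w2; linear_combination w4 + d * w3 + w2) (by
        rintro p q r s (⟨k, hk, h1, h2, h3, h5⟩ | ⟨i, h⟩) hp
        · have := hR k hk
          have h3' : (r : ℤ) = 0 := by exact_mod_cast h3
          linarith
        · omega)
    linarith
  -- Conditions 1 and 3 follow from 4, because `d - 1 ≥ 1` and the slope is positive.
  refine ⟨?_, ?_, ?_, ?_, ?_, ?_, ?_⟩
  · zify; linarith
  · zify; linarith
  · zify; linarith
  · linarith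
  · linarith
  · intro h; linarith [c6 h]
  · intro h; linarith [c7 h]

lemma orderAdditive_iff_criterion (he : Ideal.span (Set.range (e.binomials K)) = toricIdeal K n)
    (h3 : e.a32 + e.a34 < e.a3) : OrderAdditive n ↔ e.Criterion :=
  ⟨criterion_of_orderAdditive he h3, orderAdditive_of_criterion he h3⟩

end Exponents

end MonomialCurve

/-! ### Cohen–Macaulayness of rings that are quotients of a line modulo nilpotents. -/

namespace MonomialCurve

section GradedLine

open Polynomial IsLocalRing

variable {K G : Type*} [Field K] [CommRing G] (φ : K[X] →+* G)

/-- Primes contain the nilradical, so contraction to `K[X]` is strictly monotone on them. -/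
lemma ringKrullDim_le_one_of_surjective_mod_nilradical
    (hφ : ∀ y, ∃ g, y - φ g ∈ nilradical G) : ringKrullDim G ≤ 1 := by
  rw [← IsPrincipalIdealRing.ringKrullDim_eq_one K[X] (Polynomial.not_isField K)]
  refine Order.krullDim_le_of_strictMono (PrimeSpectrum.comap φ) fun p q hpq => ?_
  obtain ⟨hle, y, hyq, hyp⟩ := SetLike.lt_iff_le_and_exists.1
    (show p.asIdeal < q.asIdeal from hpq)
  obtain ⟨g, hg⟩ := hφ y
  have hgp := nilradical_le_prime p.asIdeal hg
  show (PrimeSpectrum.comap φ p).asIdeal < (PrimeSpectrum.comap φ q).asIdeal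
  refine SetLike.lt_iff_le_and_exists.2 ⟨Ideal.comap_mono hle, g, ?_, fun h => hyp ?_⟩
  · exact (Submodule.sub_mem_iff_right q.asIdeal hyq).1 (hle hgp)
  · exact (Submodule.sub_mem_iff_left p.asIdeal h).1 hgp

/-- Otherwise `K[X]` would be isomorphic to the field `G ⧸ P`. -/
lemma exists_ne_zero_map_mem (hφ : ∀ y, ∃ g, y - φ g ∈ nilradical G) (P : Ideal G) [P.IsMaximal] :
    ∃ g ≠ 0, φ g ∈ P := by
  by_contra! hcon
  let ψ := (Ideal.Quotient.mk P).comp φ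
  have hinj : Function.Injective ψ := by
    rw [injective_iff_map_eq_zero]
    intro g hg
    by_contra h
    exact hcon g h (Ideal.Quotient.eq_zero_iff_mem.1 hg)
  have hsurj : Function.Surjective ψ := by
    intro y
    obtain ⟨y, rfl⟩ := Ideal.Quotient.mk_surjective y
    obtain ⟨g, hg⟩ := hφ y
    refine ⟨g, ?_⟩
    exact (Ideal.Quotient.eq.2 (nilradical_le_prime P hg)).symm
  exact Polynomial.not_isField K ((RingEquiv.ofBijective ψ ⟨hinj, hsurj⟩).toMulEquiv.isField
    ((Ideal.Quotient.maximal_ideal_iff_isField_quotient P).1 inferInstance))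

/-- A Noetherian ring which, modulo nilpotents, is a quotient of `K[X]`, and on which the nonzero
polynomials act as nonzerodivisors, is Cohen–Macaulay. -/
lemma isCohenMacaulayRing_of_nonZeroDivisors [IsNoetherianRing G]
    (hφ : ∀ y, ∃ g, y - φ g ∈ nilradical G) (hreg : ∀ g ≠ 0, φ g ∈ nonZeroDivisors G) :
    IsCohenMacaulayRing G := by
  refine ⟨inferInstance, fun P hP => ?_⟩
  have hnoeth : IsNoetherianRing (Localization.AtPrime P) :=
    IsLocalization.isNoetherianRing P.primeCompl _ inferInstance
  obtain ⟨g, hg0, hgP⟩ := exists_ne_zero_map_mem φ hφ P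
  set y := algebraMap G (Localization.AtPrime P) (φ g) with hy
  have hyP : y ∈ maximalIdeal (Localization.AtPrime P) :=
    (IsLocalization.AtPrime.to_map_mem_maximal_iff (Localization.AtPrime P) P _).2 hgP
  have hyreg : IsSMulRegular (Localization.AtPrime P) y := by
    refine IsSMulRegular.of_flat (R := G) ?_
    rw [isSMulRegular_iff_right_eq_zero_of_smul]
    exact fun z hz => (mem_nonZeroDivisors_iff.1 (hreg g hg0)).1 z hz
  have hreg' : RingTheory.Sequence.IsRegular (Localization.AtPrime P) [y] := by
    refine (RingTheory.Sequence.isRegular_iff _ _).2 ⟨?_, ?_⟩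
    · rw [RingTheory.Sequence.isWeaklyRegular_singleton_iff]
      exact hyreg
    · intro htop
      have : (⊤ : Ideal (Localization.AtPrime P)) ≤ maximalIdeal _ := by
        rw [htop]
        simpa [Ideal.span_le] using hyP
      exact (maximalIdeal.isMaximal (Localization.AtPrime P)).ne_top (top_le_iff.1 this)
  refine ⟨hnoeth, [y], by simpa using hyP, hreg', ?_⟩
  have h1 : ringKrullDim (Localization.AtPrime P) ≤ 1 := by
    rw [IsLocalization.AtPrime.ringKrullDim_eq_height P]
    exact (Ideal.height_le_ringKrullDim_of_ne_top hP.ne_top).trans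
      (ringKrullDim_le_one_of_surjective_mod_nilradical φ hφ)
  have h2 := ringKrullDim_quotient_succ_le_of_nonZeroDivisor
    (R := Localization.AtPrime P) (r := y) (by
      rw [mem_nonZeroDivisors_iff_right]
      intro z hz
      exact hyreg.right_eq_zero_of_smul (by rw [smul_eq_mul, mul_comm, hz]))
  have : Nontrivial (Localization.AtPrime P ⧸ Ideal.span {y}) := by
    refine Ideal.Quotient.nontrivial_iff.2 fun htop => ?_
    have : (⊤ : Ideal (Localization.AtPrime P)) ≤ maximalIdeal _ := by
      rw [← htop]
      simpa [Ideal.span_le] using hyP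
    exact (maximalIdeal.isMaximal (Localization.AtPrime P)).ne_top (top_le_iff.1 this)
  have h3 : 0 ≤ ringKrullDim (Localization.AtPrime P ⧸ Ideal.span {y}) :=
    ringKrullDim_nonneg_of_nontrivial
  refine le_antisymm ?_ h1
  refine le_trans ?_ h2
  simpa using add_le_add_left h3 1

/-- A polynomial mapping into `P` has constant term zero, since a nonzero constant maps to a unit.
So `P` lies in the radical of `(φ X)`. -/
lemma exists_pow_le_span_map_X [IsNoetherianRing G] (hφ : ∀ y, ∃ g, y - φ g ∈ nilradical G)
    (P : Ideal G) [P.IsMaximal] (hX : φ X ∈ P) : ∃ N, P ^ N ≤ Ideal.span {φ X} := by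
  refine Ideal.exists_pow_le_of_le_radical_of_fg (fun y hy => ?_) (IsNoetherian.noetherian P)
  obtain ⟨g, hg⟩ := hφ y
  have hgP : φ g ∈ P :=
    (Submodule.sub_mem_iff_right P hy).1 (nilradical_le_prime P hg)
  have hdiv : φ g ∈ Ideal.span {φ X} := by
    have h1 : g = X * g.divX + C (g.coeff 0) := (X_mul_divX_add g).symm
    have h2 : φ (C (g.coeff 0)) ∈ P := by
      rw [h1, map_add, map_mul] at hgP
      exact (Submodule.add_mem_iff_right P (P.mul_mem_right _ hX)).1 hgP
    have h3 : g.coeff 0 = 0 := by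
      by_contra h
      refine Ideal.IsPrime.ne_top (I := P) inferInstance (Ideal.eq_top_of_isUnit_mem P h2 ?_)
      exact ((isUnit_iff_ne_zero.2 h).map C).map φ
    rw [h3, C_0, add_zero] at h1
    rw [h1, map_mul]
    exact Ideal.mul_mem_right _ _ (Ideal.mem_span_singleton_self _)
  have : y = (y - φ g) + φ g := by ring
  rw [this]
  refine Ideal.add_mem _ ?_ (Ideal.le_radical hdiv)
  obtain ⟨k, hk⟩ := hg
  exact ⟨k, by rw [hk]; exact zero_mem _⟩

/-- If a Cohen–Macaulay ring is, modulo nilpotents, a quotient of `K[X]`, then `X` acts as a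
nonzerodivisor, provided that the ideals generated by its powers are all distinct. -/
lemma map_X_mem_nonZeroDivisors_of_isCohenMacaulayRing (hφ : ∀ y, ∃ g, y - φ g ∈ nilradical G)
    (hX : ∀ k : ℕ, φ X ^ k ∉ Ideal.span {φ X ^ (k + 1)}) (hG : IsCohenMacaulayRing G) :
    φ X ∈ nonZeroDivisors G := by
  rw [mem_nonZeroDivisors_iff_left]
  intro f hf
  obtain ⟨hnoeth, hCM⟩ := hG
  obtain ⟨P, hP, hXP⟩ := exists_max_ideal_of_mem_nonunits (a := φ X) (by
    intro h
    refine hX 0 ?_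
    rw [zero_add, pow_one, Ideal.span_singleton_eq_top.2 h]
    trivial)
  obtain ⟨N, hN⟩ := exists_pow_le_span_map_X φ hφ P hXP
  obtain ⟨-, rs, hrs, hreg, hlen⟩ := hCM P
  have hcomax : ∀ s ∉ P, ∀ M : ℕ, ∃ r, 1 - r * s ∈ P ^ M := by
    intro s hs M
    have h1 : Ideal.span {s} ⊔ P = ⊤ := by
      refine hP.1.2 _ (lt_of_le_of_ne le_sup_right fun h => hs ?_)
      rw [h]
      exact Ideal.mem_sup_left (Ideal.mem_span_singleton_self s)
    have h2 : Ideal.span {s} ⊔ P ^ M = ⊤ := Ideal.sup_pow_eq_top h1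
    obtain ⟨a, ha, b, hb, hab⟩ := Submodule.mem_sup.1 (h2 ▸ Submodule.mem_top (x := (1 : G)))
    obtain ⟨r, rfl⟩ := Ideal.mem_span_singleton'.1 ha
    exact ⟨r, by rwa [← hab, add_sub_cancel_left]⟩
  -- In dimension zero some `s ∉ P` kills `φ X ^ k`. As `s` is invertible modulo `P ^ N ≤ (φ X)`,
  -- this puts `φ X ^ k` in `(φ X ^ (k + 1))`.
  have hne : rs ≠ [] := by
    rintro rfl
    have hzero : Ring.KrullDimLE 0 (Localization.AtPrime P) := by
      rw [ringKrullDimZero_iff_ringKrullDim_eq_zero, ← hlen]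
      simp
    have hnil : IsNilpotent (algebraMap G (Localization.AtPrime P) (φ X)) :=
      Ring.KrullDimLE.isNilpotent_iff_mem_maximalIdeal.2
        ((IsLocalization.AtPrime.to_map_mem_maximal_iff (Localization.AtPrime P) P _).2 hXP)
    obtain ⟨k, hk⟩ := hnil
    rw [← map_pow, IsLocalization.map_eq_zero_iff P.primeCompl] at hk
    obtain ⟨⟨s, hs⟩, hsk⟩ := hk
    obtain ⟨r, hr⟩ := hcomax s hs N
    obtain ⟨c, hc⟩ := Ideal.mem_span_singleton'.1 (hN hr)
    refine hX k (Ideal.mem_span_singleton'.2 ⟨c, ?_⟩)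
    have hsk' : s * φ X ^ k = 0 := hsk
    calc c * φ X ^ (k + 1) = (c * φ X) * φ X ^ k := by ring
      _ = (1 - r * s) * φ X ^ k := by rw [hc]
      _ = φ X ^ k - r * (s * φ X ^ k) := by ring
      _ = φ X ^ k := by rw [hsk', mul_zero, sub_zero]
  obtain ⟨y, rs', rfl⟩ := List.exists_cons_of_ne_nil hne
  have hyreg := ((RingTheory.Sequence.isRegular_cons_iff _ _ _).1 hreg).1
  obtain ⟨⟨a, t⟩, hat⟩ := IsLocalization.surj P.primeCompl y
  have haP : a ∈ P := by
    rw [← IsLocalization.AtPrime.to_map_mem_maximal_iff (Localization.AtPrime P) P, ← hat]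
    exact Ideal.mul_mem_right _ _ (hrs y (by simp))
  -- `P ^ N` kills `f`, while the localization has a regular element in its maximal ideal; hence `f`
  -- vanishes there. Some `s ∉ P` then kills `f`, and `s` is comaximal with `P ^ N`.
  have hPf : ∀ b ∈ P ^ N, b * f = 0 := by
    intro b hb
    obtain ⟨c, rfl⟩ := Ideal.mem_span_singleton'.1 (hN hb)
    rw [mul_assoc, hf, mul_zero]
  have hloc : algebraMap G (Localization.AtPrime P) f = 0 := by
    refine (hyreg.pow N).right_eq_zero_of_smul ?_
    have ht := IsLocalization.map_units (Localization.AtPrime P) t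
    refine ((ht.pow N).mul_right_eq_zero).1 ?_
    rw [smul_eq_mul, ← mul_assoc, ← mul_pow, mul_comm _ y]
    rw [hat, ← map_pow, ← map_mul, hPf _ (Ideal.pow_mem_pow haP N), map_zero]
  rw [IsLocalization.map_eq_zero_iff P.primeCompl] at hloc
  obtain ⟨⟨s, hs⟩, hsf⟩ := hloc
  obtain ⟨r, hr⟩ := hcomax s hs N
  have hsf' : s * f = 0 := hsf
  have := hPf _ hr
  rwa [sub_mul, one_mul, mul_assoc, hsf', mul_zero, sub_zero] at this

variable {A : Type*} [CommRing A] {J : Ideal A} {ψ : K[X] →+* A}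

lemma exists_sub_mem_nilradical_quotient (hψ : ∀ y, ∃ g, y - ψ g ∈ J.radical) (y : A ⧸ J) :
    ∃ g, y - (Ideal.Quotient.mk J).comp ψ g ∈ nilradical (A ⧸ J) := by
  obtain ⟨y, rfl⟩ := Ideal.Quotient.mk_surjective y
  obtain ⟨g, k, hk⟩ := hψ y
  refine ⟨g, k, ?_⟩
  rw [RingHom.comp_apply, ← map_sub, ← map_pow]
  exact Ideal.Quotient.eq_zero_iff_mem.2 hk

lemma isCohenMacaulayRing_quotient [IsNoetherianRing A]
    (hψ : ∀ y, ∃ g, y - ψ g ∈ J.radical) (hreg : ∀ g ≠ 0, ∀ y, ψ g * y ∈ J → y ∈ J) :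
    IsCohenMacaulayRing (A ⧸ J) := by
  refine isCohenMacaulayRing_of_nonZeroDivisors ((Ideal.Quotient.mk J).comp ψ)
    (exists_sub_mem_nilradical_quotient hψ) fun g hg => ?_
  rw [mem_nonZeroDivisors_iff_left]
  intro y hy
  obtain ⟨y, rfl⟩ := Ideal.Quotient.mk_surjective y
  rw [RingHom.comp_apply, ← map_mul, Ideal.Quotient.eq_zero_iff_mem] at hy
  exact Ideal.Quotient.eq_zero_iff_mem.2 (hreg g hg y hy)

lemma mem_of_isCohenMacaulayRing_quotient (hψ : ∀ y, ∃ g, y - ψ g ∈ J.radical)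
    (hX : ∀ (k : ℕ) (c : A), c * ψ X ^ (k + 1) - ψ X ^ k ∉ J)
    (hJ : IsCohenMacaulayRing (A ⧸ J)) (y : A) (hy : ψ X * y ∈ J) : y ∈ J := by
  have h1 := map_X_mem_nonZeroDivisors_of_isCohenMacaulayRing ((Ideal.Quotient.mk J).comp ψ)
    (exists_sub_mem_nilradical_quotient hψ) (fun k hk => by
      obtain ⟨c, hc⟩ := Ideal.mem_span_singleton'.1 hk
      obtain ⟨c, rfl⟩ := Ideal.Quotient.mk_surjective c
      rw [RingHom.comp_apply, ← map_pow (Ideal.Quotient.mk J), ← map_pow (Ideal.Quotient.mk J),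
        ← map_mul, Ideal.Quotient.eq] at hc
      exact hX k c hc) hJ
  rw [mem_nonZeroDivisors_iff_left] at h1
  rw [← Ideal.Quotient.eq_zero_iff_mem]
  refine h1 _ ?_
  rw [RingHom.comp_apply, ← map_mul, Ideal.Quotient.eq_zero_iff_mem]
  exact hy

end GradedLine

end MonomialCurve

/-! ### Powers of the maximal ideal and factorization lengths. -/

namespace MonomialCurve

section Factorizations

variable {r : ℕ} {n : Fin r → ℕ}

lemma HasFactorization.mono {i j s : ℕ} (h : HasFactorization n i s) (hij : j ≤ i) :
    HasFactorization n j s := by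
  obtain ⟨v, h1, h2⟩ := h
  exact ⟨v, h1, hij.trans h2⟩

lemma HasFactorization.add {i j s t : ℕ} (h : HasFactorization n i s)
    (h' : HasFactorization n j t) : HasFactorization n (i + j) (s + t) := by
  obtain ⟨v, h1, h2⟩ := h
  obtain ⟨w, h3, h4⟩ := h'
  refine ⟨v + w, ?_, ?_⟩
  · simp [add_mul, Finset.sum_add_distrib, h1, h3]
  · simp only [Pi.add_apply, Finset.sum_add_distrib]
    omega

lemma hasFactorization_one_self (j : Fin r) : HasFactorization n 1 (n j) :=
  ⟨Pi.single j 1, by simp [Pi.single_apply, ite_mul], by simp [Pi.single_apply]⟩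

lemma mem_semigroup_iff {s : ℕ} : s ∈ semigroup n ↔ HasFactorization n 0 s := by
  constructor
  · intro h
    induction h using AddSubmonoid.closure_induction with
    | mem x hx =>
      obtain ⟨j, rfl⟩ := hx
      exact (hasFactorization_one_self j).mono zero_le_one
    | zero => exact ⟨0, by simp, by simp⟩
    | add x y _ _ hx hy => exact hx.add hy
  · rintro ⟨v, rfl, -⟩
    refine sum_mem fun j _ => ?_
    rw [← smul_eq_mul]
    exact nsmul_mem (AddSubmonoid.subset_closure (Set.mem_range_self j)) _

lemma HasFactorization.exists_generator {i s : ℕ} (h : HasFactorization n (i + 1) s) :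
    ∃ j, n j ≤ s ∧ HasFactorization n i (s - n j) := by
  obtain ⟨v, h1, h2⟩ := h
  obtain ⟨j, -, hj⟩ := Finset.exists_ne_zero_of_sum_ne_zero (f := v) (s := Finset.univ) (by omega)
  have hv : v = (v - Pi.single j 1) + Pi.single j 1 := by
    refine (tsub_add_cancel_of_le fun k => ?_).symm
    by_cases hk : k = j
    · subst hk; simpa using Nat.one_le_iff_ne_zero.2 hj
    · simp [hk]
  have e1 : ∑ k, v k * n k = ∑ k, (v - Pi.single j 1 : Fin r → ℕ) k * n k + n j := by
    conv_lhs => rw [hv]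
    simp [add_mul, Finset.sum_add_distrib, Pi.single_apply, ite_mul]
  have e2 : ∑ k, v k = ∑ k, (v - Pi.single j 1 : Fin r → ℕ) k + 1 := by
    conv_lhs => rw [hv]
    simp [Finset.sum_add_distrib, Pi.single_apply]
  exact ⟨j, by omega, v - Pi.single j 1, by omega, by omega⟩

end Factorizations

section IdealPowers

variable (K : Type*) [Field K] {r : ℕ} (n : Fin r → ℕ)

/-- The power series all of whose exponents have a factorization of length at least `i`. -/
def orderIdeal (i : ℕ) : Ideal (semigroupRing K n) where
  carrier := {f | ∀ k, PowerSeries.coeff k (f : K⟦X⟧) ≠ 0 → HasFactorization n i k}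
  add_mem' := by
    intro f g hf hg k hk
    by_cases h : PowerSeries.coeff k (f : K⟦X⟧) = 0
    · refine hg k fun h' => hk ?_
      rw [Subalgebra.coe_add, map_add, h, h', add_zero]
    · exact hf k h
  zero_mem' := by
    intro k hk
    simp at hk
  smul_mem' := by
    intro a f hf k hk
    rw [smul_eq_mul, Subalgebra.coe_mul, PowerSeries.coeff_mul] at hk
    obtain ⟨p, hp, hne⟩ := Finset.exists_ne_zero_of_sum_ne_zero hk
    rw [← Finset.HasAntidiagonal.mem_antidiagonal.1 hp, ← zero_add i]
    exact (mem_semigroup_iff.1 (a.2 _ (left_ne_zero_of_mul hne))).add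
      (hf _ (right_ne_zero_of_mul hne))

variable {K n}

lemma maxIdeal_pow_le_orderIdeal (i : ℕ) : maxIdeal K n ^ i ≤ orderIdeal K n i := by
  induction i with
  | zero =>
    intro f _ k hk
    exact mem_semigroup_iff.1 (f.2 k hk)
  | succ i ih =>
    rw [pow_succ, Ideal.mul_le]
    intro f hf g hg k hk
    have hg1 : g ∈ orderIdeal K n 1 := by
      refine (Ideal.span_le.2 ?_ : maxIdeal K n ≤ _) hg
      rintro _ ⟨j, rfl⟩ k hk
      have hk' : k = n j := by
        by_contra h
        refine hk ?_
        show PowerSeries.coeff k ((PowerSeries.X : K⟦X⟧) ^ n j) = 0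
        rw [PowerSeries.coeff_X_pow, if_neg h]
      rw [hk']
      exact hasFactorization_one_self j
    rw [Subalgebra.coe_mul, PowerSeries.coeff_mul] at hk
    obtain ⟨p, hp, hne⟩ := Finset.exists_ne_zero_of_sum_ne_zero hk
    rw [← Finset.HasAntidiagonal.mem_antidiagonal.1 hp]
    exact (ih hf _ (left_ne_zero_of_mul hne)).add (hg1 _ (right_ne_zero_of_mul hne))

lemma orderIdeal_le_maxIdeal_pow [Nonempty (Fin r)] (i : ℕ) :
    orderIdeal K n i ≤ maxIdeal K n ^ i := by
  classical
  induction i with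
  | zero => simp
  | succ i ih =>
    intro f hf
    have hex : ∀ k, PowerSeries.coeff k (f : K⟦X⟧) ≠ 0 → ∃ j,
        n j ≤ k ∧ HasFactorization n i (k - n j) := fun k hk => (hf k hk).exists_generator
    choose! j hj using hex
    -- Each exponent of `f` is assigned to one generator that can be split off, so the infinitely
    -- many terms group into `r` series.
    let g : Fin r → K⟦X⟧ := fun l => PowerSeries.mk fun k =>
      if j (k + n l) = l then PowerSeries.coeff (k + n l) (f : K⟦X⟧) else 0
    have hg : ∀ l k, PowerSeries.coeff k (g l) ≠ 0 → HasFactorization n i k := by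
      intro l k hk
      rw [PowerSeries.coeff_mk] at hk
      split_ifs at hk with h
      · have := (hj _ hk).2
        rwa [h, Nat.add_sub_cancel] at this
      · exact absurd rfl hk
    let G : Fin r → semigroupRing K n := fun l =>
      ⟨g l, fun k hk => mem_semigroup_iff.2 ((hg l k hk).mono (Nat.zero_le i))⟩
    have hfG : f = ∑ l, G l * generator K n l := by
      apply Subtype.ext
      ext k
      have : ((∑ l, G l * generator K n l : semigroupRing K n) : K⟦X⟧) =
          ∑ l, g l * PowerSeries.X ^ n l := by
        rw [AddSubmonoidClass.coe_finsetSum]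
        rfl
      rw [this, map_sum]
      have hterm : ∀ l, PowerSeries.coeff k (g l * PowerSeries.X ^ n l) =
          if l = j k then PowerSeries.coeff k (f : K⟦X⟧) else 0 := by
        intro l
        rw [PowerSeries.coeff_mul_X_pow']
        split_ifs with h1 h2 h2
        · rw [PowerSeries.coeff_mk, Nat.sub_add_cancel h1, if_pos h2.symm]
        · rw [PowerSeries.coeff_mk, Nat.sub_add_cancel h1, if_neg fun h => h2 h.symm]
        · by_contra h
          exact h1 (h2 ▸ (hj k fun h' => h h'.symm).1)
        · rfl
      rw [Finset.sum_congr rfl fun l _ => hterm l]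
      simp
    rw [hfG, pow_succ]
    exact sum_mem fun l _ => Ideal.mul_mem_mul (ih (hg l))
      (Ideal.subset_span (Set.mem_range_self l))

lemma mem_maxIdeal_pow [Nonempty (Fin r)] {i : ℕ} {f : semigroupRing K n} :
    f ∈ maxIdeal K n ^ i ↔
      ∀ k, PowerSeries.coeff k (f : K⟦X⟧) ≠ 0 → HasFactorization n i k :=
  ⟨fun h => maxIdeal_pow_le_orderIdeal i h, fun h => orderIdeal_le_maxIdeal_pow i h⟩

/-- The element `t ^ s` of `R`. -/
noncomputable def power (K : Type*) [Field K] {s : ℕ} (hs : HasFactorization n 0 s) :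
    semigroupRing K n :=
  ⟨PowerSeries.X ^ s, by
    intro k hk
    rw [PowerSeries.coeff_X_pow] at hk
    split_ifs at hk with h
    · exact h ▸ mem_semigroup_iff.2 hs
    · exact absurd rfl hk⟩

lemma mem_maxIdeal_pow_of_coe_eq_X_pow [Nonempty (Fin r)] {i s : ℕ} {f : semigroupRing K n}
    (hf : (f : K⟦X⟧) = PowerSeries.X ^ s) :
    f ∈ maxIdeal K n ^ i ↔ HasFactorization n i s := by
  rw [mem_maxIdeal_pow, hf]
  constructor
  · intro h
    exact h s (by simp)
  · intro h k hk
    rw [PowerSeries.coeff_X_pow] at hk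
    split_ifs at hk with h'
    · exact h' ▸ h
    · exact absurd rfl hk

lemma coe_generator_pow (j : Fin r) (k : ℕ) :
    ((generator K n j ^ k : semigroupRing K n) : K⟦X⟧) = PowerSeries.X ^ (k * n j) := by
  rw [mul_comm, pow_mul]
  rfl

end IdealPowers

end MonomialCurve

/-! ### The Rees algebra and the tangent cone. -/

namespace MonomialCurve

open Polynomial

section Rees

variable {A : Type*} [CommRing A] {I : Ideal A}

/-- The element `a T ^ i` of the Rees algebra. -/
noncomputable def reesMonomial (i : ℕ) (a : A) (ha : a ∈ I ^ i) : reesAlgebra I :=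
  ⟨monomial i a, reesAlgebra.monomial_mem.2 ha⟩

lemma mem_map_algebraMap_reesAlgebra {f : reesAlgebra I} :
    f ∈ I.map (algebraMap A (reesAlgebra I)) ↔ ∀ i, (f : A[X]).coeff i ∈ I ^ (i + 1) := by
  constructor
  · intro hf
    induction hf using Submodule.span_induction with
    | mem x hx =>
      obtain ⟨a, ha, rfl⟩ := hx
      intro i
      show (C a : A[X]).coeff i ∈ _
      rw [coeff_C]
      split_ifs with h
      · subst h; simpa using ha
      · exact zero_mem _
    | zero => simp
    | add x y _ _ hx hy => exact fun i => by simpa using add_mem (hx i) (hy i)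
    | smul a x _ hx =>
      intro i
      rw [smul_eq_mul, Subalgebra.coe_mul, coeff_mul]
      refine sum_mem fun p hp => ?_
      rw [← Finset.HasAntidiagonal.mem_antidiagonal.1 hp, add_assoc, pow_add]
      exact Ideal.mul_mem_mul (a.2 p.1) (hx p.2)
  · intro hf
    have hmon : ∀ i, ∀ a ∈ I * I ^ i, ∃ z ∈ I.map (algebraMap A (reesAlgebra I)),
        (z : A[X]) = monomial i a := by
      intro i a ha
      refine Submodule.mul_induction_on ha ?_ ?_
      · intro b hb c hc
        refine ⟨algebraMap A (reesAlgebra I) b * reesMonomial i c hc,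
          Ideal.mul_mem_right _ _ (Ideal.mem_map_of_mem _ hb), ?_⟩
        show C b * monomial i c = _
        rw [C_mul_monomial]
      · rintro x y ⟨z, hz, hzx⟩ ⟨w, hw, hwy⟩
        exact ⟨z + w, add_mem hz hw, by rw [Subalgebra.coe_add, hzx, hwy, map_add]⟩
    have hsum : f = ∑ i ∈ (f : A[X]).support, reesMonomial i ((f : A[X]).coeff i) (f.2 i) := by
      apply Subtype.ext
      rw [AddSubmonoidClass.coe_finsetSum]
      exact (f : A[X]).as_sum_support
    rw [hsum]
    refine sum_mem fun i _ => ?_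
    obtain ⟨z, hz, hzi⟩ := hmon i _ (pow_succ' I i ▸ hf i)
    have : reesMonomial i ((f : A[X]).coeff i) (f.2 i) = z := Subtype.ext hzi.symm
    rwa [this]

/-- A ring homomorphism to the Rees algebra is surjective modulo the radical of the ideal defining
the associated graded ring if its image contains, modulo this radical, the elements of degree zero
and a set of generators in degree one. -/
lemma exists_sub_mem_radical_of_span {B : Type*} [CommRing B] (ψ : B →+* reesAlgebra I)
    {J : Ideal (reesAlgebra I)} {S : Set A} (hS : I = Ideal.span S)
    (hconst : ∀ a : A, ∃ g, algebraMap A (reesAlgebra I) a - ψ g ∈ J)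
    (hgen : ∀ a ∈ S, ∀ h : a ∈ I ^ 1, ∃ g, reesMonomial 1 a h - ψ g ∈ J)
    (y : reesAlgebra I) : ∃ g, y - ψ g ∈ J := by
  have hadd : ∀ y z : reesAlgebra I, (∃ g, y - ψ g ∈ J) → (∃ g, z - ψ g ∈ J) →
      ∃ g, y + z - ψ g ∈ J := by
    rintro y z ⟨g, hg⟩ ⟨h, hh⟩
    refine ⟨g + h, ?_⟩
    rw [map_add, add_sub_add_comm]
    exact add_mem hg hh
  have hmul : ∀ y z : reesAlgebra I, (∃ g, y - ψ g ∈ J) → (∃ g, z - ψ g ∈ J) →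
      ∃ g, y * z - ψ g ∈ J := by
    rintro y z ⟨g, hg⟩ ⟨h, hh⟩
    refine ⟨g * h, ?_⟩
    have : y * z - ψ (g * h) = (y - ψ g) * z + ψ g * (z - ψ h) := by
      rw [map_mul]; ring
    rw [this]
    exact add_mem (Ideal.mul_mem_right _ _ hg) (Ideal.mul_mem_left _ _ hh)
  have hlin : ∀ a ∈ Ideal.span S, ∀ h : a ∈ I ^ 1, ∃ g, reesMonomial 1 a h - ψ g ∈ J := by
    intro a ha
    induction ha using Submodule.span_induction with
    | mem x hx => exact hgen x hx
    | zero =>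
      intro h
      refine ⟨0, ?_⟩
      have : reesMonomial 1 0 h = 0 := Subtype.ext (map_zero (monomial 1))
      rw [this, map_zero, sub_zero]
      exact zero_mem _
    | add x y hx hy ihx ihy =>
      intro h
      have hx' : x ∈ I ^ 1 := by rw [pow_one, hS]; exact hx
      have hy' : y ∈ I ^ 1 := by rw [pow_one, hS]; exact hy
      have : reesMonomial 1 (x + y) h = reesMonomial 1 x hx' + reesMonomial 1 y hy' :=
        Subtype.ext (map_add (monomial 1) x y)
      rw [this]
      exact hadd _ _ (ihx _) (ihy _)
    | smul a x hx ih =>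
      intro h
      have hx' : x ∈ I ^ 1 := by rw [pow_one, hS]; exact hx
      have : reesMonomial 1 (a • x) h = algebraMap A (reesAlgebra I) a * reesMonomial 1 x hx' := by
        apply Subtype.ext
        show monomial 1 (a * x) = C a * monomial 1 x
        rw [C_mul_monomial]
      rw [this]
      exact hmul _ _ (hconst a) (ih _)
  have hadj : ∀ f ∈ Algebra.adjoin A
      (Submodule.map (monomial 1 : A →ₗ[A] A[X]) I : Set A[X]),
      ∃ z : reesAlgebra I, (z : A[X]) = f ∧ ∃ g, z - ψ g ∈ J := by
    intro f hf
    induction hf using Algebra.adjoin_induction with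
    | mem x hx =>
      obtain ⟨a, ha, rfl⟩ := hx
      have ha' : a ∈ I ^ 1 := by rw [pow_one]; exact ha
      exact ⟨reesMonomial 1 a ha', rfl, hlin a (hS ▸ ha) ha'⟩
    | algebraMap a => exact ⟨algebraMap A (reesAlgebra I) a, rfl, hconst a⟩
    | add x y _ _ ihx ihy =>
      obtain ⟨z, rfl, hz⟩ := ihx
      obtain ⟨w, rfl, hw⟩ := ihy
      exact ⟨z + w, rfl, hadd z w hz hw⟩
    | mul x y _ _ ihx ihy =>
      obtain ⟨z, rfl, hz⟩ := ihx
      obtain ⟨w, rfl, hw⟩ := ihy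
      exact ⟨z * w, rfl, hmul z w hz hw⟩
  obtain ⟨z, hz, g, hg⟩ := hadj y (by rw [adjoin_monomial_eq_reesAlgebra]; exact y.2)
  obtain rfl : z = y := Subtype.ext hz
  exact ⟨g, hg⟩

end Rees

section AssociatedGraded

variable (K : Type*) [Field K] (n : Fin 4 → ℕ)

/-- The element `t ^ (n j) T` of the Rees algebra. -/
noncomputable def reesGenerator (j : Fin 4) : reesAlgebra (maxIdeal K n) :=
  reesMonomial 1 (generator K n j) (by
    rw [pow_one]; exact Ideal.subset_span (Set.mem_range_self j))

/-- The kernel of the projection from the Rees algebra to `gr_𝔪(R)`. -/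
noncomputable def gradedKernel : Ideal (reesAlgebra (maxIdeal K n)) :=
  (maxIdeal K n).map (algebraMap (semigroupRing K n) (reesAlgebra (maxIdeal K n)))

/-- The homomorphism from `K[X]` to the Rees algebra sending `X` to `t ^ (n_1) T`. -/
noncomputable def lineMap : K[X] →+* reesAlgebra (maxIdeal K n) :=
  eval₂RingHom ((algebraMap (semigroupRing K n) (reesAlgebra (maxIdeal K n))).comp
    (algebraMap K (semigroupRing K n))) (reesGenerator K n 0)

variable {K n}

lemma coe_reesGenerator_pow (j : Fin 4) (k : ℕ) :
    ((reesGenerator K n j ^ k : reesAlgebra (maxIdeal K n)) : (semigroupRing K n)[X]) =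
      monomial k (generator K n j ^ k) := by
  rw [Subalgebra.coe_pow]
  show (monomial 1 (generator K n j)) ^ k = _
  rw [monomial_pow, one_mul]

lemma mem_gradedKernel {f : reesAlgebra (maxIdeal K n)} : f ∈ gradedKernel K n ↔
    ∀ i, (f : (semigroupRing K n)[X]).coeff i ∈ maxIdeal K n ^ (i + 1) :=
  mem_map_algebraMap_reesAlgebra

lemma lineMap_X : lineMap K n X = reesGenerator K n 0 := by
  rw [lineMap, coe_eval₂RingHom, eval₂_X]

lemma lineMap_C (c : K) : lineMap K n (C c) =
    algebraMap (semigroupRing K n) (reesAlgebra (maxIdeal K n))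
      (algebraMap K (semigroupRing K n) c) := by
  rw [lineMap, coe_eval₂RingHom, eval₂_C, RingHom.comp_apply]

lemma coeff_lineMap (g : K[X]) (i : ℕ) :
    (lineMap K n g : (semigroupRing K n)[X]).coeff i =
      algebraMap K (semigroupRing K n) (g.coeff i) * generator K n 0 ^ i := by
  induction g using Polynomial.induction_on' with
  | add p q hp hq =>
    rw [map_add, Subalgebra.coe_add, coeff_add, hp, hq, coeff_add, map_add, add_mul]
  | monomial k c =>
    rw [← C_mul_X_pow_eq_monomial, map_mul, map_pow, lineMap_X, lineMap_C, Subalgebra.coe_mul,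
      coe_reesGenerator_pow, C_mul_X_pow_eq_monomial]
    show (C (algebraMap K (semigroupRing K n) c) * _ : (semigroupRing K n)[X]).coeff i = _
    rw [C_mul_monomial, coeff_monomial, coeff_monomial]
    split_ifs with h
    · rw [h]
    · simp

/-- In degree `k` only `t^(k n_1)` remains, and by minimality of `n 0` no factorization of `k * n 0`
has more than `k` terms. -/
lemma mul_pow_lineMap_X_sub_notMem (hpos : 0 < n 0) (hmin : ∀ i, n 0 ≤ n i) (k : ℕ)
    (c : reesAlgebra (maxIdeal K n)) :
    c * lineMap K n X ^ (k + 1) - lineMap K n X ^ k ∉ gradedKernel K n := by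
  intro hc
  rw [lineMap_X, mem_gradedKernel] at hc
  have h1 := hc k
  rw [Subalgebra.coe_sub, Subalgebra.coe_mul, coe_reesGenerator_pow, coe_reesGenerator_pow,
    ← C_mul_X_pow_eq_monomial, ← mul_assoc, coeff_sub, coeff_mul_X_pow', if_neg (by omega),
    coeff_monomial, if_pos rfl, zero_sub, neg_mem_iff,
    mem_maxIdeal_pow_of_coe_eq_X_pow (coe_generator_pow 0 k)] at h1
  obtain ⟨v, hv, hle⟩ := h1
  have h2 : n 0 * ∑ j, v j ≤ ∑ j, v j * n j := by
    rw [Finset.mul_sum]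
    exact Finset.sum_le_sum fun j _ => by rw [mul_comm]; exact Nat.mul_le_mul_left _ (hmin j)
  nlinarith

lemma algebraMap_sub_mem_maxIdeal (f : semigroupRing K n) :
    f - algebraMap K (semigroupRing K n) (PowerSeries.coeff 0 (f : K⟦X⟧)) ∈ maxIdeal K n := by
  rw [← pow_one (maxIdeal K n), mem_maxIdeal_pow]
  intro k hk
  have h0 : k ≠ 0 := by
    rintro rfl
    refine hk ?_
    rw [Subalgebra.coe_sub, map_sub, Subalgebra.coe_algebraMap, PowerSeries.algebraMap_apply]
    simp
  obtain ⟨v, rfl, -⟩ := mem_semigroup_iff.1 ((f - algebraMap K (semigroupRing K n)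
    (PowerSeries.coeff 0 (f : K⟦X⟧))).2 k hk)
  refine ⟨v, rfl, Nat.one_le_iff_ne_zero.2 fun h => h0 ?_⟩
  rw [Finset.sum_eq_zero_iff] at h
  exact Finset.sum_eq_zero fun j hj => by rw [h j hj, zero_mul]

/-- The `n 0`-th power has coefficient `t^(n_1 n_j)`, which is also an `n j`-th power of `t^(n_1)`.
-/
lemma reesGenerator_mem_radical {j : Fin 4} (hj : n 0 < n j) :
    reesGenerator K n j ∈ (gradedKernel K n).radical := by
  refine ⟨n 0, ?_⟩
  rw [mem_gradedKernel]
  intro i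
  rw [coe_reesGenerator_pow, coeff_monomial]
  split_ifs with h
  · subst h
    rw [mem_maxIdeal_pow_of_coe_eq_X_pow (coe_generator_pow j _)]
    exact ⟨Pi.single 0 (n j), by simp [Pi.single_apply, mul_comm],
      by simpa [Pi.single_apply] using hj⟩
  · exact zero_mem _

lemma exists_sub_lineMap_mem_radical (hmin : ∀ j, j ≠ 0 → n 0 < n j)
    (y : reesAlgebra (maxIdeal K n)) : ∃ g, y - lineMap K n g ∈ (gradedKernel K n).radical := by
  refine exists_sub_mem_radical_of_span (lineMap K n) (S := Set.range (generator K n)) rfl ?_ ?_ y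
  · intro a
    refine ⟨C (PowerSeries.coeff 0 (a : K⟦X⟧)), Ideal.le_radical ?_⟩
    rw [lineMap_C, ← map_sub]
    exact Ideal.mem_map_of_mem _ (algebraMap_sub_mem_maxIdeal a)
  · rintro _ ⟨j, rfl⟩ _
    rcases eq_or_ne j 0 with rfl | hj
    · refine ⟨X, ?_⟩
      rw [lineMap_X]
      exact (sub_self (reesGenerator K n 0)).symm ▸ zero_mem _
    · refine ⟨0, ?_⟩
      rw [map_zero, sub_zero]
      exact reesGenerator_mem_radical (hmin j hj)

lemma OrderAdditive.iterate (h : OrderAdditive n) {s : ℕ} (hs : HasFactorization n 0 s) (i k : ℕ)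
    (hi : HasFactorization n (i + k) (s + k * n 0)) : HasFactorization n i s := by
  induction k generalizing i with
  | zero => simpa using hi
  | succ k ih =>
    refine ih i (h _ ?_ _ ?_)
    · simpa using hs.add ((hasFactorization_four (n := n) (i := 0)).2
        ⟨k, 0, 0, 0, by simp, Nat.zero_le _⟩)
    · rw [add_assoc i, add_assoc s, ← Nat.succ_mul]
      exact hi

/-- Trailing term argument: in degree `m + i` the other terms pair lower coefficients of `f`,
handled by induction, with powers of `X` above `m`, so the trailing term times the `i`-th
coefficient is itself in `𝔪^(m+i+1)`. -/
lemma mem_gradedKernel_of_lineMap_mul_mem (h : OrderAdditive n) {g : K[X]} (hg : g ≠ 0)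
    (f : reesAlgebra (maxIdeal K n)) (hy : lineMap K n g * f ∈ gradedKernel K n) :
    f ∈ gradedKernel K n := by
  rw [mem_gradedKernel] at hy ⊢
  set m := g.natTrailingDegree with hm
  have hc : g.coeff m ≠ 0 := trailingCoeff_nonzero_iff_nonzero.2 hg
  intro i
  induction i using Nat.strong_induction_on with
  | _ i ih =>
  have h1 := hy (m + i)
  rw [Subalgebra.coe_mul, coeff_mul] at h1
  rw [← Finset.add_sum_erase _ _ (Finset.HasAntidiagonal.mem_antidiagonal.2 rfl :
    (m, i) ∈ Finset.HasAntidiagonal.antidiagonal (m + i))] at h1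
  have h2 : (algebraMap K (semigroupRing K n) (g.coeff m) * generator K n 0 ^ m) *
      (f : (semigroupRing K n)[X]).coeff i ∈ maxIdeal K n ^ (m + i + 1) := by
    rw [← coeff_lineMap]
    refine (Submodule.add_mem_iff_left _ (sum_mem fun p hp => ?_)).1 h1
    obtain ⟨hne, hp⟩ := Finset.mem_erase.1 hp
    rw [Finset.HasAntidiagonal.mem_antidiagonal] at hp
    rw [coeff_lineMap]
    rcases lt_trichotomy p.1 m with hlt | heq | hgt
    · rw [coeff_eq_zero_of_lt_natTrailingDegree hlt, map_zero, zero_mul, zero_mul]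
      exact zero_mem _
    · exact absurd (Prod.ext heq (by omega)) hne
    · rw [← hp, add_assoc, pow_add]
      refine Ideal.mul_mem_mul (Ideal.mul_mem_left _ _ (Ideal.pow_mem_pow ?_ _)) (ih p.2 (by omega))
      exact Ideal.subset_span (Set.mem_range_self _)
  rw [mem_maxIdeal_pow] at h2 ⊢
  intro k hk
  have hkS := mem_semigroup_iff.1 (((f : (semigroupRing K n)[X]).coeff i).2 k hk)
  refine h.iterate hkS (i + 1) m ?_
  have h3 := h2 (k + m * n 0) (by
    rw [Subalgebra.coe_mul, Subalgebra.coe_mul, coe_generator_pow, Subalgebra.coe_algebraMap,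
      PowerSeries.algebraMap_apply, mul_assoc, PowerSeries.coeff_C_mul, PowerSeries.coeff_X_pow_mul]
    exact mul_ne_zero hc hk)
  exact h3.mono (by omega)

lemma orderAdditive_of_lineMap_X_mul_mem
    (h : ∀ f, lineMap K n X * f ∈ gradedKernel K n → f ∈ gradedKernel K n) :
    OrderAdditive n := by
  intro s hs i hi
  suffices ∀ j ≤ i, HasFactorization n j s from this i le_rfl
  intro j hj
  induction j with
  | zero => exact hs
  | succ j ih =>
    have hjs := ih (by omega)
    have hpow : power K hs ∈ maxIdeal K n ^ j := (mem_maxIdeal_pow_of_coe_eq_X_pow rfl).2 hjs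
    -- The test element is `t^s T^j`; its product with `X` is `t^(s + n_1) T^(j+1)`, which vanishes
    -- in the tangent cone as `i + 1 ≥ j + 2`.
    have h1 := h (reesMonomial j _ hpow) (by
      rw [lineMap_X, mem_gradedKernel]
      intro k
      show (monomial 1 (generator K n 0) * monomial j (power K hs)).coeff k ∈ _
      rw [monomial_mul_monomial, coeff_monomial]
      split_ifs with hk
      · rw [mem_maxIdeal_pow_of_coe_eq_X_pow (s := n 0 + s)]
        · rw [add_comm (n 0)]
          exact hi.mono (by omega)
        · rw [pow_add]
          rfl
      · exact zero_mem _)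
    rw [mem_gradedKernel] at h1
    have h2 := h1 j
    change (monomial j (power K hs)).coeff j ∈ _ at h2
    rwa [coeff_monomial, if_pos rfl, mem_maxIdeal_pow_of_coe_eq_X_pow (s := s) rfl] at h2

/-- The tangent cone is Cohen–Macaulay if and only if adding `n_1` to an element of the semigroup
raises its order by one only. -/
lemma isCohenMacaulayRing_associatedGraded_iff (hnoeth : IsNoetherianRing (semigroupRing K n))
    (hpos : 0 < n 0) (hmin : ∀ j, j ≠ 0 → n 0 < n j) :
    IsCohenMacaulayRing (AssociatedGraded (maxIdeal K n)) ↔ OrderAdditive n := by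
  have hψ := exists_sub_lineMap_mem_radical (K := K) hmin
  have hX := mul_pow_lineMap_X_sub_notMem (K := K) hpos fun i => by
    rcases eq_or_ne i 0 with hi | hi
    · rw [hi]
    · exact (hmin i hi).le
  constructor
  · intro hCM
    exact orderAdditive_of_lineMap_X_mul_mem (mem_of_isCohenMacaulayRing_quotient hψ hX hCM)
  · intro h
    exact isCohenMacaulayRing_quotient hψ fun g hg => mem_gradedKernel_of_lineMap_mul_mem h hg

end AssociatedGraded

end MonomialCurve
-- The criterion for the tangent cone.
theorem theorem2p6 {K : Type*} [Field K] (n : Fin 4 → ℕ)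
    (hpos : ∀ i, 0 < n i) (hinj : Function.Injective n) (hgcd : Finset.univ.gcd n = 1)
    (hmin : ∀ i, n 0 ≤ n i)
    (hGor : MonomialCurve.IsGorenstein K n)
    (hnci : ¬ MonomialCurve.IsCompleteIntersection K n)
    (e : MonomialCurve.Exponents)
    (he : MonomialCurve.IsMinimallyGeneratedBy K n e)
    (h3 : e.a32 + e.a34 < e.a3) :
    MonomialCurve.IsCohenMacaulayRing
        (MonomialCurve.AssociatedGraded (MonomialCurve.maxIdeal K n)) ↔
      (e.a2 ≤ e.a21 + e.a23 ∧
       e.a4 ≤ e.a41 + e.a42 ∧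
       e.a42 + e.a13 ≤ e.a21 + e.a34 ∧
       ((e.d : ℤ) - 1) * ((e.a3 : ℤ) - e.a32 - e.a34) + e.a2 - e.a21 - e.a23 ≤ 0 ∧
       ((e.d : ℤ) - 1) * ((e.a3 : ℤ) - e.a32 - e.a34) + e.a4 + e.a32 - e.a1 - e.a23 ≤ 0 ∧
       ((e.a4 : ℤ) - e.d * e.a34 > 0 →
         (e.d : ℤ) * ((e.a3 : ℤ) - e.a32 - e.a34) + e.a2 - e.a21 - e.a23 ≤ 0) ∧
       ((e.a4 : ℤ) - e.d * e.a34 ≤ 0 →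
         (e.d : ℤ) * ((e.a3 : ℤ) - e.a32 - e.a34) + e.a4 + e.a32 - e.a1 - e.a23 ≤ 0)) := by
  -- Injectivity makes the minimum strict, as the nilpotence of the other generators requires.
  rw [MonomialCurve.isCohenMacaulayRing_associatedGraded_iff hGor.isNoetherianRing (hpos 0)
    fun j hj => lt_of_le_of_ne (hmin j) fun h => hj (hinj h).symm]
  exact MonomialCurve.Exponents.orderAdditive_iff_criterion he.1 h3
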